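/- Let $F$ be an algebraically closed field and let $L$ be a finite-dimensional (left) Leibniz algebra over $F$, i.e. an algebra with $a(bc)=(ab)c+b(ac)$. Let $\mathrm{Leib}(L)$ denote the span of all squares $aa$, $a\in L$; $L$ is Lie if $aa=0$ for all $a$. Call $L$ *supersolvable* if it has a chain of (two-sided) ideals $0=L_0\subset L_1\subset\dots\subset L_n=L$ with $\dim L_i=i$; *minimally non-supersolvable* if $L$ is not supersolvable but every proper subalgebra is; and *$\phi$-free* if the only ideal of $L$ contained in the intersection of all maximal subalgebras of $L$ is $0$. Then $L$ is solvable, $\phi$-free and minimally non-supersolvable if and only if $F$ has prime characteristic $p$ and $L$ is of one of the following two types (indices $i$ are taken mod $p$): (a) $L=A\dotplus B$ (direct sum of vector spaces), where $A$ has basis $e_1,\dots,e_p$, $A$ is abelian ($A^2=0$) and is the unique minimal ideal of $L$, $B$ is the Lie subalgebra with basis $x,y$ and $xy=-yx=x$, with left action $xe_i=-e_{i+1}$, $ye_i=-i\,e_i$; and either $L$ is Lie or $A=\mathrm{Leib}(L)$; (b) $L=A\dotplus B$, where $A$ has basis $e_1,\dots,e_p$, $A$ is abelian and is the unique minimal ideal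 of $L$, $B$ is the Heisenberg Lie subalgebra with basis $x,y,z$, $xy=-yx=z$ and $z$ central in $B$, with left action $xe_i=-e_{i+1}$, $ye_i=(i+1)e_{i-1}$, $ze_i=e_i$; and either $L$ is Lie or $A=\mathrm{Leib}(L)$. -/

import Mathlib

/-- A left Leibniz algebra: a nonassociative algebra with `a(bc) = (ab)c + b(ac)`. -/
class IsLeibniz (L : Type*) [NonUnitalNonAssocRing L] : Prop where
  leibniz : ∀ a b c : L, a * (b * c) = (a * b) * c + b * (a * c)

namespace Leibniz

variable (F : Type*) [Field F]
variable (L : Type*) [NonUnitalNonAssocRing L] [Module F L]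

/-- A Leibniz algebra is a Lie algebra when its product is alternating. -/
def IsLie : Prop := ∀ a : L, a * a = 0

/-- `Leib(L)`, the linear span of all squares. -/
def leib : Submodule F L := Submodule.span F {w | ∃ a : L, w = a * a}

variable {F L} in
/-- Two-sided ideals. -/
def IsIdeal (I : Submodule F L) : Prop :=
  ∀ a : L, ∀ x ∈ I, a * x ∈ I ∧ x * a ∈ I

variable {F L} in
/-- Minimal ideals: nonzero ideals that contain no ideals but `0` and themselves. -/
def IsMinimalIdeal (A : Submodule F L) : Prop :=
  IsIdeal A ∧ A ≠ ⊥ ∧ ∀ J : Submodule F L, IsIdeal J → J ≤ A → J = ⊥ ∨ J = A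

variable {F L} in
/-- `A` is a minimal ideal, and there is no other one. -/
def IsUniqueMinimalIdeal (A : Submodule F L) : Prop :=
  IsMinimalIdeal A ∧ ∀ J : Submodule F L, IsMinimalIdeal J → J = A

/-- The derived series `L ⊇ L² ⊇ (L²)² ⊇ …`. -/
def derivedSeries : ℕ → Submodule F L
  | 0 => ⊤
  | n + 1 => Submodule.span F
      {w | ∃ a ∈ derivedSeries n, ∃ b ∈ derivedSeries n, w = a * b}

/-- Solvability. -/
def IsSolvable : Prop := ∃ n, derivedSeries F L n = ⊥

/-- Supersolvability: there is a chain `0 = I 0 ⊆ I 1 ⊆ … ⊆ I n = L` of ideals of `L` with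
`I i` of dimension `i`. -/
def IsSupersolvable : Prop :=
  ∃ (n : ℕ) (I : ℕ → Submodule F L), I 0 = ⊥ ∧ I n = ⊤ ∧
    (∀ i < n, I i ≤ I (i + 1)) ∧
    ∀ i ≤ n, IsIdeal (I i) ∧ Module.finrank F (I i) = i

/-- `L` is not supersolvable, but all its proper subalgebras are. -/
def IsMinimallyNonSupersolvable [IsScalarTower F L L] [SMulCommClass F L L] : Prop :=
  ¬ IsSupersolvable F L ∧ ∀ K : NonUnitalSubalgebra F L, K ≠ ⊤ → IsSupersolvable F K

/-- The Frattini subalgebra: the intersection of all maximal subalgebras. -/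
def frattiniSubalgebra [IsScalarTower F L L] [SMulCommClass F L L] : NonUnitalSubalgebra F L :=
  sInf {M : NonUnitalSubalgebra F L | IsCoatom M}

/-- The Frattini ideal: the largest ideal contained in the Frattini subalgebra (the sum of all
the ideals contained in it). -/
def frattiniIdeal [IsScalarTower F L L] [SMulCommClass F L L] : Submodule F L :=
  sSup {I : Submodule F L | IsIdeal I ∧ ∀ x ∈ I, x ∈ frattiniSubalgebra F L}

/-- `L` is `φ`-free: its Frattini ideal is zero. -/
def IsPhiFree [IsScalarTower F L L] [SMulCommClass F L L] : Prop := frattiniIdeal F L = ⊥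

/-- The first type: `e i` (`i` modulo `p`), `x`, `y` form a basis of `L`, the span `A` of the `e i`
is abelian and is the unique minimal ideal, `B = ⟨x, y⟩` is the two-dimensional nonabelian Lie
algebra with `xy = x`, acting on `A` from the left as displayed, and `L` is Lie or
`A = Leib(L)`. -/
def IsTypeA (p : ℕ) : Prop :=
  ∃ (e : ZMod p → L) (x y : L),
    LinearIndependent F (Sum.elim e ![x, y]) ∧
    Submodule.span F (Set.range (Sum.elim e ![x, y])) = ⊤ ∧
    IsUniqueMinimalIdeal (Submodule.span F (Set.range e)) ∧
    (∀ i j, e i * e j = 0) ∧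
    (∀ i, x * e i = - e (i + 1)) ∧
    (∀ i, y * e i = - ((i.val : F) • e i)) ∧
    x * y = x ∧ y * x = - x ∧ x * x = 0 ∧ y * y = 0 ∧
    (IsLie L ∨ Submodule.span F (Set.range e) = leib F L)

/-- The second type: `e i` (`i` modulo `p`), `x`, `y`, `z` form a basis of `L`, the span `A` of
the `e i` is abelian and is the unique minimal ideal, `B = ⟨x, y, z⟩` is the Heisenberg Lie algebra
with `xy = z`, acting on `A` from the left as displayed, and `L` is Lie or `A = Leib(L)`. -/
def IsTypeB (p : ℕ) : Prop :=
  ∃ (e : ZMod p → L) (x y z : L),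
    LinearIndependent F (Sum.elim e ![x, y, z]) ∧
    Submodule.span F (Set.range (Sum.elim e ![x, y, z])) = ⊤ ∧
    IsUniqueMinimalIdeal (Submodule.span F (Set.range e)) ∧
    (∀ i j, e i * e j = 0) ∧
    (∀ i, x * e i = - e (i + 1)) ∧
    (∀ i, y * e i = ((i.val : F) + 1) • e (i - 1)) ∧
    (∀ i, z * e i = e i) ∧
    x * y = z ∧ y * x = - z ∧ x * x = 0 ∧ y * y = 0 ∧ z * z = 0 ∧
    x * z = 0 ∧ z * x = 0 ∧ y * z = 0 ∧ z * y = 0 ∧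
    (IsLie L ∨ Submodule.span F (Set.range e) = leib F L)

end Leibniz

set_option linter.unusedSectionVars false

/-! Forward direction. A minimal ideal `A` of a solvable algebra is abelian, and since `L` is φ-free
some maximal subalgebra `M` does not contain it; then `L = A + M`, and `A ∩ M` is an ideal, hence
zero. The complement `M` is supersolvable, so `A` cannot be one-dimensional, or `L` would be
supersolvable. A second minimal ideal would inherit an eigenvector from `M` and be one-dimensional;
hence `A` is unique. It follows that `M` acts faithfully and irreducibly on `A`, and that `M` is
Lie, because squares act as zero from the left. For a proper subalgebra `S` of `M`, `A + S` is
proper, hence supersolvable, so `S` has a common eigenvector in `A`. This is the situation recorded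
in `IsCritical`.

A common eigenvector of `x` and `y` is killed by `xy`. So if `xy` acts injectively on `A`, a
subalgebra containing `x` and `y` must be all of `M`. The first two steps of a flag of ideals of `M`
supply such a pair (`exists_type_of_flag`), with either `xy = x` or `xy` central and acting as a
nonzero scalar; this forces `M` to be the two-dimensional nonabelian algebra or the Heisenberg
algebra.

In both cases the action amounts to operators with `XY - YX = 1`: in the first case `Y` is `x⁻¹y` on
`A`, in the second `Y` is `y` itself, up to normalization. Taking traces forces prime characteristic
`p`. Then `X ^ p` commutes with everything, so it is a scalar by Schur's lemma and can be normalized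
to `-1`. Subtracting a scalar from `Y` gives a vector `u` with `Yu = 0`, and the `p` vectors `(-X)^k
u` are the required basis (`exists_cyclic_basis`).

Converse. `A` is a minimal ideal of dimension `p ≠ 1`, so `L` is not supersolvable, and its
complement is a maximal subalgebra, so `L` is φ-free. A proper subalgebra `K` either has all its
products in `A`, and then acts on `A` by commuting, hence simultaneously triangularizable,
operators; or it satisfies `A + K = L`, and then it meets `A` trivially and all its products lie on
a line. -/

namespace Leibniz

/-! ### Ideals, minimal ideals and chains of ideals. -/

section Ideals

variable {F : Type*} [Field F] {L : Type*} [NonUnitalNonAssocRing L] [Module F L]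

theorem isIdeal_bot : IsIdeal (⊥ : Submodule F L) := by
  intro a x hx
  rw [Submodule.mem_bot] at hx
  simp [hx]

theorem IsIdeal.inf {I J : Submodule F L} (hI : IsIdeal I) (hJ : IsIdeal J) :
    IsIdeal (I ⊓ J) := fun a x hx =>
  ⟨⟨(hI a x hx.1).1, (hJ a x hx.2).1⟩, ⟨(hI a x hx.1).2, (hJ a x hx.2).2⟩⟩

theorem IsIdeal.sup {I J : Submodule F L} (hI : IsIdeal I) (hJ : IsIdeal J) :
    IsIdeal (I ⊔ J) := by
  intro a x hx
  obtain ⟨y, hy, z, hz, rfl⟩ := Submodule.mem_sup.1 hx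
  rw [mul_add, add_mul]
  exact ⟨Submodule.add_mem_sup (hI a y hy).1 (hJ a z hz).1,
    Submodule.add_mem_sup (hI a y hy).2 (hJ a z hz).2⟩

/-- A nonzero ideal of a finite-dimensional algebra contains a minimal ideal. -/
theorem IsIdeal.exists_isMinimalIdeal_le [FiniteDimensional F L] {I : Submodule F L}
    (hI : IsIdeal I) (h : I ≠ ⊥) : ∃ A, IsMinimalIdeal A ∧ A ≤ I := by
  obtain ⟨A, ⟨hA, hA0, hAI⟩, hmin⟩ := (wellFounded_lt (α := Submodule F L)).has_min
    {J | IsIdeal J ∧ J ≠ ⊥ ∧ J ≤ I} ⟨I, hI, h, le_rfl⟩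
  refine ⟨A, ⟨hA, hA0, fun J hJ hJA => ?_⟩, hAI⟩
  by_contra! hne
  exact hmin J ⟨hJ, hne.1, hJA.trans hAI⟩ (lt_of_le_of_ne hJA hne.2)

/-- A nonzero ideal of a supersolvable algebra contains a one-dimensional ideal. -/
theorem IsSupersolvable.exists_eigenvector [FiniteDimensional F L] (h : IsSupersolvable F L)
    {J : Submodule F L} (hJ : IsIdeal J) (hJ0 : J ≠ ⊥) :
    ∃ v ∈ J, v ≠ 0 ∧ ∀ a, (∃ c : F, a * v = c • v) ∧ ∃ c : F, v * a = c • v := by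
  classical
  obtain ⟨n, I, h0, hn, hle, hI⟩ := h
  -- At the least such `i` the intersection meets the previous term trivially, so it embeds in a
  -- one-dimensional quotient and is a one-dimensional ideal.
  have hex : ∃ i, J ⊓ I i ≠ ⊥ := ⟨n, by rwa [hn, inf_top_eq]⟩
  have hfn : Nat.find hex ≤ n := Nat.find_min' hex (by rwa [hn, inf_top_eq])
  have hspec := Nat.find_spec hex
  obtain ⟨k, hk⟩ : ∃ k, Nat.find hex = k + 1 := by
    refine Nat.exists_eq_succ_of_ne_zero fun h => hspec ?_
    rw [h, h0, inf_bot_eq]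
  have hkmin : J ⊓ I k = ⊥ := by
    by_contra hne
    exact Nat.find_min hex (by omega) hne
  rw [hk] at hspec hfn
  have hsum := Submodule.finrank_sup_add_finrank_inf_eq (J ⊓ I (k + 1)) (I k)
  have hinf : J ⊓ I (k + 1) ⊓ I k = ⊥ := by
    rw [inf_assoc, inf_eq_right.2 (hle k (by omega)), hkmin]
  have hsup : J ⊓ I (k + 1) ⊔ I k ≤ I (k + 1) := sup_le inf_le_right (hle k (by omega))
  have hfin := Submodule.finrank_mono hsup
  rw [hinf, finrank_bot, (hI k (by omega)).2] at hsum
  rw [(hI (k + 1) hfn).2] at hfin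
  have hpos : 0 < Module.finrank F ↥(J ⊓ I (k + 1)) :=
    Nat.pos_of_ne_zero fun h => hspec (Submodule.finrank_eq_zero.1 h)
  have hone : Module.finrank F ↥(J ⊓ I (k + 1)) = 1 := by omega
  obtain ⟨v, hv, hv0⟩ := Submodule.exists_mem_ne_zero_of_ne_bot hspec
  have key : ∀ w ∈ J ⊓ I (k + 1), ∃ c : F, w = c • v := by
    intro w hw
    obtain ⟨c, hc⟩ := exists_smul_eq_of_finrank_eq_one hone
      (x := (⟨v, hv⟩ : ↥(J ⊓ I (k + 1)))) (by simpa using hv0) ⟨w, hw⟩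
    exact ⟨c, (congrArg Subtype.val hc).symm⟩
  have hid := hJ.inf (hI (k + 1) hfn).1
  exact ⟨v, hv.1, hv0, fun a => ⟨key _ (hid a v hv).1, key _ (hid a v hv).2⟩⟩

theorem finrank_sup_span_singleton [FiniteDimensional F L] {I : Submodule F L} {v : L}
    (hv : v ∉ I) : Module.finrank F ↥(I ⊔ F ∙ v) = Module.finrank F I + 1 := by
  have hv0 : v ≠ 0 := fun h => hv (h ▸ I.zero_mem)
  have hsum := Submodule.finrank_sup_add_finrank_inf_eq I (F ∙ v)
  have hinf : I ⊓ F ∙ v = ⊥ := by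
    rw [eq_bot_iff]
    rintro w ⟨hw, hw'⟩
    obtain ⟨c, rfl⟩ := Submodule.mem_span_singleton.1 hw'
    by_cases hc : c = 0
    · simp [hc]
    · exact absurd ((Submodule.smul_mem_iff _ hc).1 hw) hv
  rw [hinf, finrank_bot, finrank_span_singleton hv0] at hsum
  simpa using hsum

variable [IsScalarTower F L L] [SMulCommClass F L L]

theorem IsIdeal.sup_span_singleton {I : Submodule F L} (hI : IsIdeal I) {v : L}
    (hv : ∀ a, a * v ∈ I ⊔ F ∙ v ∧ v * a ∈ I ⊔ F ∙ v) : IsIdeal (I ⊔ F ∙ v) := by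
  intro a x hx
  obtain ⟨y, hy, z, hz, rfl⟩ := Submodule.mem_sup.1 hx
  obtain ⟨c, rfl⟩ := Submodule.mem_span_singleton.1 hz
  rw [mul_add, add_mul, mul_smul_comm, smul_mul_assoc]
  exact ⟨add_mem (Submodule.mem_sup_left (hI a y hy).1) (Submodule.smul_mem _ _ (hv a).1),
    add_mem (Submodule.mem_sup_left (hI a y hy).2) (Submodule.smul_mem _ _ (hv a).2)⟩

/-- An algebra is supersolvable if each proper ideal can be enlarged by one dimension. -/
theorem isSupersolvable_of_forall_exists [FiniteDimensional F L]
    (h : ∀ I : Submodule F L, IsIdeal I → I ≠ ⊤ →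
      ∃ v ∉ I, ∀ a, a * v ∈ I ⊔ F ∙ v ∧ v * a ∈ I ⊔ F ∙ v) : IsSupersolvable F L := by
  have step : ∀ I : {I : Submodule F L // IsIdeal I}, ∃ J : {I : Submodule F L // IsIdeal I},
      I.1 ≤ J.1 ∧ (I.1 ≠ ⊤ → Module.finrank F J.1 = Module.finrank F I.1 + 1) := by
    rintro ⟨I, hI⟩
    by_cases hT : I = ⊤
    · exact ⟨⟨I, hI⟩, le_rfl, fun h => absurd hT h⟩
    · obtain ⟨v, hv, hva⟩ := h I hI hT
      exact ⟨⟨I ⊔ F ∙ v, hI.sup_span_singleton hva⟩, le_sup_left,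
        fun _ => finrank_sup_span_singleton hv⟩
  choose next hle hnext using step
  let f : ℕ → {I : Submodule F L // IsIdeal I} := fun k => next^[k] ⟨⊥, isIdeal_bot⟩
  have hf : ∀ k, f (k + 1) = next (f k) := fun k => Function.iterate_succ_apply' _ _ _
  have hfin : ∀ k ≤ Module.finrank F L, Module.finrank F (f k).1 = k := by
    intro k
    induction k with
    | zero => intro _; exact finrank_bot F L
    | succ k ih =>
      intro hk
      have hk' := ih (by omega)
      rw [hf, hnext, hk']
      intro hT
      rw [hT, finrank_top] at hk'
      omega
  refine ⟨Module.finrank F L, fun k => (f k).1, rfl,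
    Submodule.eq_top_of_finrank_eq (hfin _ le_rfl), fun i _ => ?_, fun i hi =>
    ⟨(f i).2, hfin i hi⟩⟩
  simp only [hf]
  exact hle _

end Ideals

/-! ### The relation `XY - YX = 1`, Schur's lemma and commuting operators. -/

section Weyl

variable {F : Type*} [Field F] {V : Type*} [AddCommGroup V] [Module F V]

/-- The canonical commutation relation is only possible in prime characteristic. -/
theorem exists_charP_of_commutator_eq_one [FiniteDimensional F V] [Nontrivial V]
    {X Y : Module.End F V} (h : X * Y - Y * X = 1) : ∃ p : ℕ, p.Prime ∧ CharP F p := by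
  have ht := congrArg (LinearMap.trace F V) h
  rw [map_sub, LinearMap.trace_mul_comm, sub_self, LinearMap.trace_one] at ht
  obtain ⟨p, hp⟩ := CharP.exists F
  refine ⟨p, (CharP.char_is_prime_or_zero F p).resolve_right ?_, hp⟩
  rintro rfl
  have := CharP.charP_to_charZero F
  exact Module.finrank_pos.ne' (Nat.cast_eq_zero.1 ht.symm)

/-- The commutator with `Y` is a derivation sending `X` to `1`, so it acts on powers of `X` as
`d/dX`. -/
theorem pow_mul_sub_mul_pow {R : Type*} [Ring R] {X Y : R} (h : X * Y - Y * X = 1) (n : ℕ) :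
    X ^ n * Y - Y * X ^ n = n * X ^ (n - 1) := by
  induction n with
  | zero => simp
  | succ n ih =>
    have h1 : X * Y = Y * X + 1 := by rw [← h]; abel
    have h2 : X ^ n * Y = Y * X ^ n + n * X ^ (n - 1) := by rw [← ih]; abel
    rw [pow_succ, mul_assoc, h1, mul_add, ← mul_assoc, h2]
    rcases n with _ | n
    · simp
    · simp only [Nat.add_sub_cancel]
      push_cast
      rw [add_mul, mul_assoc, mul_assoc, ← pow_succ, ← pow_succ]
      noncomm_ring

theorem commute_pow_char {p : ℕ} [CharP F p] {X Y : Module.End F V} (h : X * Y - Y * X = 1) :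
    Commute (X ^ p) Y := by
  have := pow_mul_sub_mul_pow h p
  rw [commute_iff_eq, ← sub_eq_zero, this]
  have h0 : ((p : ℕ) : Module.End F V) = 0 := by
    rw [← map_natCast (algebraMap F (Module.End F V)), CharP.cast_eq_zero, map_zero]
  rw [h0, zero_mul]

/-- A vacuum vector of a representation of the first Weyl algebra on which the `p`-th power of the
raising operator is `-1` yields a cyclic basis. -/
theorem exists_cyclic_basis {p : ℕ} [Fact p.Prime] [CharP F p]
    {X Y : Module.End F V} (h : X * Y - Y * X = 1) (hX : X ^ p = -1) {u : V} (hu : u ≠ 0)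
    (hY : Y u = 0)
    (hirr : ∀ W : Submodule F V, (∀ w ∈ W, X w ∈ W ∧ Y w ∈ W) → W = ⊥ ∨ W = ⊤) :
    ∃ f : ZMod p → V, LinearIndependent F f ∧ Submodule.span F (Set.range f) = ⊤ ∧
      (∀ i, X (f i) = - f (i + 1)) ∧ ∀ i, Y (f i) = (i.val : F) • f (i - 1) := by
  have hp : p.Prime := Fact.out
  have : NeZero p := ⟨hp.ne_zero⟩
  set g : ℕ → V := fun k => ((-X) ^ k) u with hg
  have hnX : (-X) ^ p = 1 := by
    have : (-X) ^ p = (-1) ^ p * X ^ p := by rw [← neg_one_mul, (Commute.neg_one_left X).mul_pow]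
    rw [this, hX]
    have h1 : ((-1 : Module.End F V)) ^ p = -1 := by
      have := congrArg (algebraMap F (Module.End F V)) (neg_one_pow_char F p)
      simpa using this
    rw [h1]; simp
  have hper : ∀ k, g (k + p) = g k := by
    intro k
    simp only [hg, pow_add, hnX, mul_one]
  have hgX : ∀ k, X (g k) = - g (k + 1) := by
    intro k
    simp [hg, pow_succ']
  have hgY : ∀ k, Y (g (k + 1)) = ((k + 1 : ℕ) : F) • g k := by
    intro k
    induction k with
    | zero =>
      have := LinearMap.congr_fun h u
      simp [hY] at this
      simp [hg, this]
    | succ k ih =>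
      have h1 := LinearMap.congr_fun h (g (k + 1))
      simp only [LinearMap.sub_apply, Module.End.mul_apply, ih, hgX, map_neg, map_smul,
        Module.End.one_apply] at h1
      rw [smul_neg, sub_neg_eq_add] at h1
      have h2 := eq_add_of_neg_add_eq h1
      rw [h2]
      push_cast
      module
  have hmod : ∀ k, g (k % p) = g k := by
    intro k
    conv_rhs => rw [← Nat.mod_add_div k p]
    generalize k / p = m
    induction m with
    | zero => simp
    | succ m ih => rw [mul_add, mul_one, ← add_assoc, hper, ih]
  -- A further power of `-X` brings `g k` back to `u`, since `(-X) ^ p = 1`.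
  have hg0 : ∀ k, g k ≠ 0 := by
    intro k hk
    have h1 : ((-X) ^ p) ^ k = (-X) ^ (p * k - k) * (-X) ^ k := by
      rw [← pow_mul, ← pow_add]
      congr 1
      have := Nat.le_mul_of_pos_left k hp.pos
      omega
    rw [hnX, one_pow] at h1
    have h2 := LinearMap.congr_fun h1 u
    rw [Module.End.mul_apply] at h2
    change u = ((-X) ^ (p * k - k)) (g k) at h2
    rw [hk, map_zero] at h2
    exact hu h2
  let f : ZMod p → V := fun i => g i.val
  have hfX : ∀ i, X (f i) = - f (i + 1) := by
    intro i
    simp only [f]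
    rw [hgX, ZMod.val_add, hmod, ZMod.val_one_eq_one_mod, ← hmod, ← hmod (i.val + 1 % p),
      Nat.add_mod_mod]
  have hfY' : ∀ i, Y (f (i + 1)) = ((i + 1).val : F) • f i := by
    intro i
    have hXf := hfX i
    have h1 : f (i + 1) = g (i.val + 1) := by
      have := hgX i.val
      simp only [f] at hXf ⊢
      rw [this] at hXf
      exact (neg_injective hXf).symm
    have h2 : ((i + 1).val : F) = ((i.val + 1 : ℕ) : F) := by
      rw [ZMod.val_add, ZMod.val_one_eq_one_mod, Nat.add_mod_mod, CharP.cast_eq_mod F p (i.val + 1)]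
    rw [h1, hgY, h2]
  have hfY : ∀ i, Y (f i) = (i.val : F) • f (i - 1) := by
    intro i
    simpa using hfY' (i - 1)
  have hne : ∀ i, f i ≠ 0 := fun i => hg0 _
  refine ⟨f, ?_, ?_, hfX, hfY⟩
  -- `f i` is an eigenvector of `XY` with eigenvalue `-i`, and these are distinct modulo `p`.
  · refine Module.End.eigenvectors_linearIndependent' (X * Y) (fun i : ZMod p => - (i.val : F))
      ?_ f fun i => ?_
    · intro i j hij
      have := neg_injective hij
      simp only [ZMod.natCast_val] at this
      exact ZMod.castHom_injective F this
    · rw [Module.End.hasEigenvector_iff, Module.End.mem_eigenspace_iff]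
      refine ⟨?_, hne i⟩
      rw [Module.End.mul_apply, hfY, map_smul, hfX, sub_add_cancel]
      simp
  · refine (hirr _ ?_).resolve_left ?_
    · intro w hw
      induction hw using Submodule.span_induction with
      | mem w hw =>
        obtain ⟨i, rfl⟩ := hw
        rw [hfX, hfY]
        exact ⟨neg_mem (Submodule.subset_span ⟨_, rfl⟩),
          Submodule.smul_mem _ _ (Submodule.subset_span ⟨_, rfl⟩)⟩
      | zero => simp
      | add a b _ _ ha hb =>
        rw [map_add, map_add]
        exact ⟨add_mem ha.1 hb.1, add_mem ha.2 hb.2⟩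
      | smul c a _ ha =>
        rw [map_smul, map_smul]
        exact ⟨Submodule.smul_mem _ _ ha.1, Submodule.smul_mem _ _ ha.2⟩
    · intro hbot
      have : f 0 ∈ Submodule.span F (Set.range f) := Submodule.subset_span ⟨_, rfl⟩
      rw [hbot, Submodule.mem_bot] at this
      exact hne 0 this

/-- Schur's lemma for a set of operators over an algebraically closed field. -/
theorem exists_eq_smul_one_of_commute [IsAlgClosed F] [FiniteDimensional F V] [Nontrivial V]
    {S : Set (Module.End F V)}
    (hirr : ∀ W : Submodule F V, (∀ T ∈ S, ∀ w ∈ W, T w ∈ W) → W = ⊥ ∨ W = ⊤)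
    {Z : Module.End F V} (hZ : ∀ T ∈ S, Commute T Z) : ∃ c : F, Z = c • 1 := by
  obtain ⟨c, hc⟩ := Module.End.exists_eigenvalue Z
  refine ⟨c, ?_⟩
  have := (hirr (Z.eigenspace c) fun T hT w hw => ?_).resolve_left hc
  · ext w
    have hw : w ∈ Z.eigenspace c := this ▸ Submodule.mem_top
    simpa using Module.End.mem_eigenspace_iff.1 hw
  · rw [Module.End.mem_eigenspace_iff] at hw ⊢
    have := LinearMap.congr_fun (hZ T hT).eq w
    simp only [Module.End.mul_apply] at this
    rw [← this, hw, map_smul]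

/-- Commuting operators over an algebraically closed field have a common eigenvector in each
nonzero quotient of invariant subspaces. -/
theorem exists_common_eigenvector_mod [IsAlgClosed F] [FiniteDimensional F V]
    {S : Set (Module.End F V)} (hS : ∀ T ∈ S, ∀ T' ∈ S, Commute T T') {W W' : Submodule F V}
    (hW : ∀ T ∈ S, ∀ w ∈ W, T w ∈ W) (hW' : ∀ T ∈ S, ∀ w ∈ W', T w ∈ W') (hlt : W' < W) :
    ∃ v ∈ W, v ∉ W' ∧ ∀ T ∈ S, ∃ c : F, T v - c • v ∈ W' := by
  -- For `U` minimal among the invariant subspaces strictly above `W'`, each operator has an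
  -- eigenspace in `U / W'`. It is invariant because the operators commute, so it is everything.
  -- Hence one vector of `U` outside `W'` serves all operators at once.
  obtain ⟨U, ⟨hU, hU', hUW⟩, hmin⟩ := (wellFounded_lt (α := Submodule F V)).has_min
    {U | (∀ T ∈ S, ∀ w ∈ U, T w ∈ U) ∧ W' < U ∧ U ≤ W} ⟨W, hW, hlt, le_rfl⟩
  obtain ⟨v, hv, hv'⟩ := SetLike.exists_of_lt hU'
  refine ⟨v, hUW hv, hv', fun T hT => ?_⟩
  let N : Submodule F U := W'.comap U.subtype
  let TU : Module.End F U := T.restrict (hU T hT)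
  have hN : N ≤ N.comap TU := fun w hw => hW' T hT _ hw
  have : Nontrivial (U ⧸ N) := by
    refine Submodule.Quotient.nontrivial_iff.2 fun h => hv' ?_
    have : (⟨v, hv⟩ : U) ∈ N := h ▸ Submodule.mem_top
    exact this
  obtain ⟨c, hc⟩ := Module.End.exists_eigenvalue (N.mapQ N TU hN)
  obtain ⟨q, hq⟩ := hc.exists_hasEigenvector
  obtain ⟨w, rfl⟩ := N.mkQ_surjective q
  have hq1 := Module.End.mem_eigenspace_iff.1 hq.1
  have hwc : T w - c • (w : V) ∈ W' := by
    have : TU w - c • w ∈ N := by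
      rw [← Submodule.Quotient.mk_eq_zero, Submodule.Quotient.mk_sub, sub_eq_zero]
      exact hq1
    exact this
  have hw' : (w : V) ∉ W' := fun h => hq.2 ((Submodule.Quotient.mk_eq_zero N).2 h)
  let U₁ : Submodule F V := U ⊓ W'.comap (T - c • 1)
  have hmem : ∀ {x}, x ∈ U₁ ↔ x ∈ U ∧ T x - c • x ∈ W' := by
    intro x; simp [U₁]
  have hU₁ : U₁ = U := by
    by_contra hne
    refine hmin U₁ ⟨fun T' hT' x hx => ?_, ?_, inf_le_left.trans hUW⟩
      (lt_of_le_of_ne inf_le_left hne)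
    · rw [hmem] at hx ⊢
      refine ⟨hU T' hT' x hx.1, ?_⟩
      have h1 := LinearMap.congr_fun (hS T hT T' hT').eq x
      simp only [Module.End.mul_apply] at h1
      rw [h1, ← map_smul, ← map_sub]
      exact hW' T' hT' _ hx.2
    · refine lt_of_le_of_ne (fun x hx => hmem.2 ⟨hU'.le hx, ?_⟩) fun h => hw' ?_
      · exact sub_mem (hW' T hT x hx) (Submodule.smul_mem _ _ hx)
      · rw [h]; exact hmem.2 ⟨w.2, hwc⟩
  exact ⟨c, (hmem.1 (hU₁ ▸ hv)).2⟩

end Weyl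

/-! ### Leibniz algebras, abelian minimal ideals and split extensions. -/

section Structure

variable {F : Type*} [Field F] {L : Type*} [NonUnitalNonAssocRing L] [Module F L]

theorem mul_mul_eq_sub [IsLeibniz L] (a b c : L) : (a * b) * c = a * (b * c) - b * (a * c) :=
  eq_sub_of_add_eq (IsLeibniz.leibniz a b c).symm

theorem mul_add_mul_mem_leib (a b : L) : a * b + b * a ∈ leib F L := by
  have h : a * b + b * a = (a + b) * (a + b) - a * a - b * b := by
    rw [mul_add, add_mul, add_mul]; abel
  rw [h]
  exact sub_mem (sub_mem (Submodule.subset_span ⟨_, rfl⟩) (Submodule.subset_span ⟨_, rfl⟩))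
    (Submodule.subset_span ⟨_, rfl⟩)

variable [IsScalarTower F L L] [SMulCommClass F L L]

/-- The Leibniz identity gives `(aa)b = a(ab) - a(ab) = 0`. -/
theorem mul_eq_zero_of_mem_leib [IsLeibniz L] {a : L} (ha : a ∈ leib F L) (b : L) :
    a * b = 0 := by
  induction ha using Submodule.span_induction with
  | mem w hw =>
    obtain ⟨a, rfl⟩ := hw
    rw [mul_mul_eq_sub, sub_self]
  | zero => exact zero_mul b
  | add x y _ _ hx hy => rw [add_mul, hx, hy, add_zero]
  | smul c x _ hx => rw [smul_mul_assoc, hx, smul_zero]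

theorem isIdeal_leib [IsLeibniz L] : IsIdeal (leib F L) := by
  intro a x hx
  refine ⟨?_, (mul_eq_zero_of_mem_leib hx a).symm ▸ zero_mem _⟩
  have := mul_add_mul_mem_leib (F := F) a x
  rwa [mul_eq_zero_of_mem_leib hx a, add_zero] at this

/-- By minimality `A ∩ Leib(L)` is `A` or zero. In the latter case `ax + xa`, which lies in both,
vanishes. Thus the right action on `A` is determined by the left one. -/
theorem IsMinimalIdeal.le_leib_or [IsLeibniz L] {A : Submodule F L} (hA : IsMinimalIdeal A) :
    A ≤ leib F L ∨ ∀ a ∈ A, ∀ x, a * x = -(x * a) := by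
  rcases hA.2.2 (A ⊓ leib F L) (hA.1.inf isIdeal_leib) inf_le_left with h | h
  · right
    intro a ha x
    rw [eq_neg_iff_add_eq_zero, ← Submodule.mem_bot F, ← h]
    exact ⟨add_mem (hA.1 x a ha).2 (hA.1 x a ha).1, mul_add_mul_mem_leib a x⟩
  · exact Or.inl (inf_eq_left.1 h)

theorem IsMinimalIdeal.mul_eq_zero_or [IsLeibniz L] {A : Submodule F L} (hA : IsMinimalIdeal A) :
    ∀ a ∈ A, ∀ x, a * x = 0 ∨ a * x = -(x * a) := by
  intro a ha x
  rcases hA.le_leib_or with h | h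
  · exact Or.inl (mul_eq_zero_of_mem_leib (h ha) x)
  · exact Or.inr (h a ha x)

/-- Minimal ideals of solvable algebras are abelian. -/
theorem IsMinimalIdeal.mul_eq_zero [IsLeibniz L] {A : Submodule F L} (hA : IsMinimalIdeal A)
    (hL : IsSolvable F L) : ∀ a ∈ A, ∀ b ∈ A, a * b = 0 := by
  let D : Submodule F L := Submodule.span F {w | ∃ a ∈ A, ∃ b ∈ A, w = a * b}
  have hmem : ∀ a ∈ A, ∀ b ∈ A, a * b ∈ D := fun a ha b hb =>
    Submodule.subset_span ⟨a, ha, b, hb, rfl⟩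
  have hDA : D ≤ A := by
    refine Submodule.span_le.2 ?_
    rintro _ ⟨a, ha, b, hb, rfl⟩
    exact (hA.1 a b hb).1
  have hD : IsIdeal D := by
    intro x w hw
    induction hw using Submodule.span_induction with
    | mem w hw =>
      obtain ⟨a, ha, b, hb, rfl⟩ := hw
      rw [IsLeibniz.leibniz, mul_mul_eq_sub a b x]
      exact ⟨add_mem (hmem _ (hA.1 x a ha).1 _ hb) (hmem _ ha _ (hA.1 x b hb).1),
        sub_mem (hmem _ ha _ (hA.1 x b hb).2) (hmem _ hb _ (hA.1 x a ha).2)⟩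
    | zero => simp
    | add y z _ _ hy hz =>
      rw [mul_add, add_mul]
      exact ⟨add_mem hy.1 hz.1, add_mem hy.2 hz.2⟩
    | smul c y _ hy =>
      rw [mul_smul_comm, smul_mul_assoc]
      exact ⟨Submodule.smul_mem _ _ hy.1, Submodule.smul_mem _ _ hy.2⟩
  rcases hA.2.2 D hD hDA with h | h
  · intro a ha b hb
    have := hmem a ha b hb
    rwa [h, Submodule.mem_bot] at this
  · obtain ⟨n, hn⟩ := hL
    -- If `A` equals its own square, it survives in every term of the derived series.
    have hle : ∀ k, A ≤ derivedSeries F L k := by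
      intro k
      induction k with
      | zero => exact le_top
      | succ k ih =>
        rw [← h]
        refine Submodule.span_mono ?_
        rintro _ ⟨a, ha, b, hb, rfl⟩
        exact ⟨a, ih ha, b, ih hb, rfl⟩
    exact absurd (le_bot_iff.1 (hn ▸ hle n)) hA.2.1

/-- A minimal ideal containing a common eigenvector is one-dimensional. -/
theorem IsMinimalIdeal.finrank_eq_one {A : Submodule F L} (hA : IsMinimalIdeal A) {v : L}
    (hv : v ∈ A) (hv0 : v ≠ 0) (h : ∀ a, (∃ c : F, a * v = c • v) ∧ ∃ c : F, v * a = c • v) :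
    Module.finrank F A = 1 := by
  have hid : IsIdeal (F ∙ v) := by
    have := (isIdeal_bot (F := F) (L := L)).sup_span_singleton (v := v) fun a => ?_
    · rwa [bot_sup_eq] at this
    · obtain ⟨⟨c, hc⟩, d, hd⟩ := h a
      rw [bot_sup_eq, hc, hd]
      exact ⟨Submodule.smul_mem _ _ (Submodule.mem_span_singleton_self v),
        Submodule.smul_mem _ _ (Submodule.mem_span_singleton_self v)⟩
  rcases hA.2.2 _ hid ((Submodule.span_singleton_le_iff_mem _ _).2 hv) with h' | h'
  · exact absurd (Submodule.span_singleton_eq_bot.1 h') hv0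
  · rw [← h']; exact finrank_span_singleton hv0

/-- Since `A` is abelian, only the `K`-component of an element of `L` acts on `K ∩ A`. For minimal
`A` this leaves only two possibilities: `K` meets `A` trivially or contains it. -/
theorem isIdeal_inf_of_add_eq {A : Submodule F L} (hA : IsIdeal A)
    (hab : ∀ a ∈ A, ∀ b ∈ A, a * b = 0) {K : NonUnitalSubalgebra F L}
    (hK : ∀ l, ∃ a ∈ A, ∃ k ∈ K, l = a + k) : IsIdeal (K.toSubmodule ⊓ A) := by
  rintro l x ⟨hxK, hxA⟩
  obtain ⟨a, ha, k, hk, rfl⟩ := hK l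
  rw [add_mul, mul_add, hab a ha x hxA, hab x hxA a ha, zero_add, zero_add]
  exact ⟨⟨K.mul_mem hk hxK, (hA k x hxA).1⟩, ⟨K.mul_mem hxK hk, (hA k x hxA).2⟩⟩

/-- The left action of an algebra on an ideal. -/
def leftAct {A : Submodule F L} (hA : IsIdeal A) : L →ₗ[F] Module.End F A where
  toFun a := (LinearMap.mulLeft F a).restrict fun x hx => (hA a x hx).1
  map_add' a b := by ext x; exact add_mul a b (x : L)
  map_smul' c a := by ext x; exact smul_mul_assoc c a (x : L)

@[simp]
theorem coe_leftAct {A : Submodule F L} (hA : IsIdeal A) (a : L) (x : A) :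
    (leftAct hA a x : L) = a * x := rfl

theorem leftAct_mul [IsLeibniz L] {A : Submodule F L} (hA : IsIdeal A) (a b : L) :
    leftAct hA (a * b) = leftAct hA a * leftAct hA b - leftAct hA b * leftAct hA a := by
  ext x
  simp [mul_mul_eq_sub]

/-- `L` is the direct sum of the abelian ideal `A`, on which the right action is zero or minus the
left action, and the subalgebra `M`. -/
structure IsSplit (A : Submodule F L) (M : NonUnitalSubalgebra F L) : Prop where
  isIdeal : IsIdeal A
  mul_eq_zero : ∀ a ∈ A, ∀ b ∈ A, a * b = 0
  right_mul : ∀ a ∈ A, ∀ x, a * x = 0 ∨ a * x = -(x * a)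
  eq_zero : ∀ a ∈ A, a ∈ M → a = 0
  exists_add : ∀ l, ∃ a ∈ A, ∃ m ∈ M, l = a + m

theorem IsSplit.isCoatom {A : Submodule F L} {M : NonUnitalSubalgebra F L} (h : IsSplit A M)
    (hA : IsMinimalIdeal A) : IsCoatom M := by
  refine ⟨fun hM => hA.2.1 ?_, fun K hMK => ?_⟩
  · rw [eq_bot_iff]
    intro a ha
    exact h.eq_zero a ha (hM ▸ trivial)
  · obtain ⟨k, hk, hkM⟩ := SetLike.exists_of_lt hMK
    have hK : ∀ l, ∃ a ∈ A, ∃ k ∈ K, l = a + k := fun l =>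
      let ⟨a, ha, m, hm, hl⟩ := h.exists_add l
      ⟨a, ha, m, hMK.le hm, hl⟩
    obtain ⟨a, ha, m, hm, rfl⟩ := h.exists_add k
    have haK : a ∈ K := by simpa using sub_mem hk (hMK.le hm)
    rcases hA.2.2 _ (isIdeal_inf_of_add_eq h.isIdeal h.mul_eq_zero hK) inf_le_right with h' | h'
    · have ha0 : a ∈ K.toSubmodule ⊓ A := ⟨haK, ha⟩
      rw [h', Submodule.mem_bot] at ha0
      rw [ha0, zero_add] at hkM
      exact absurd hm hkM
    · rw [eq_top_iff]
      intro l _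
      obtain ⟨a, ha, k, hk, rfl⟩ := hK l
      exact add_mem (inf_eq_right.1 h' ha) hk

/-- A nonzero ideal inside the Frattini subalgebra would contain the unique minimal ideal, which `M`
avoids. -/
theorem isPhiFree_of_isCoatom [FiniteDimensional F L] {A : Submodule F L}
    (hA : IsUniqueMinimalIdeal A) {M : NonUnitalSubalgebra F L} (hM : IsCoatom M)
    (hAM : ∀ a ∈ A, a ∈ M → a = 0) : IsPhiFree F L := by
  refine sSup_eq_bot.2 ?_
  rintro I ⟨hI, hIF⟩
  by_contra hI0
  obtain ⟨J, hJ, hJI⟩ := hI.exists_isMinimalIdeal_le hI0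
  rw [hA.2 J hJ] at hJI
  refine hA.1.2.1 (eq_bot_iff.2 fun a ha => hAM a ha ?_)
  have := hIF a (hJI ha)
  exact (sInf_le (show M ∈ {M : NonUnitalSubalgebra F L | IsCoatom M} from hM) :
    frattiniSubalgebra F L ≤ M) this

/-- Adjoin the line of `c` first; once an ideal contains `c` it contains all products, and any
vector may be adjoined. -/
theorem isSupersolvable_of_mul_eq_smul [FiniteDimensional F L] (c : L)
    (h : ∀ a b : L, ∃ r : F, a * b = r • c) : IsSupersolvable F L := by
  refine isSupersolvable_of_forall_exists fun I _ hI => ?_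
  by_cases hc : c ∈ I
  · obtain ⟨v, -, hv⟩ := SetLike.exists_of_lt (lt_top_iff_ne_top.2 hI)
    have key : ∀ a b : L, a * b ∈ I ⊔ F ∙ v := by
      intro a b
      obtain ⟨r, hr⟩ := h a b
      rw [hr]
      exact Submodule.mem_sup_left (Submodule.smul_mem _ _ hc)
    exact ⟨v, hv, fun a => ⟨key _ _, key _ _⟩⟩
  · have key : ∀ a b : L, a * b ∈ I ⊔ F ∙ c := by
      intro a b
      obtain ⟨r, hr⟩ := h a b
      rw [hr]
      exact Submodule.mem_sup_right (Submodule.smul_mem _ _ (Submodule.mem_span_singleton_self c))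
    exact ⟨c, hc, fun a => ⟨key _ _, key _ _⟩⟩

/-- Products act as zero on `A` from the left, so left multiplications commute there and common
eigenvectors modulo `I` build a flag up to `A`. Above `A` all products vanish. -/
theorem isSupersolvable_of_mul_mem [IsAlgClosed F] [FiniteDimensional F L] [IsLeibniz L]
    {A : Submodule F L} (hA : IsIdeal A) (hab : ∀ a ∈ A, ∀ b ∈ A, a * b = 0)
    (hr : ∀ a ∈ A, ∀ x, a * x = 0 ∨ a * x = -(x * a)) (hL : ∀ a b : L, a * b ∈ A) :
    IsSupersolvable F L := by
  refine isSupersolvable_of_forall_exists fun I hI hIT => ?_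
  by_cases hAI : A ≤ I
  · obtain ⟨v, -, hv⟩ := SetLike.exists_of_lt (lt_top_iff_ne_top.2 hIT)
    exact ⟨v, hv, fun a => ⟨Submodule.mem_sup_left (hAI (hL _ _)),
      Submodule.mem_sup_left (hAI (hL _ _))⟩⟩
  · have hlt : I.comap A.subtype < ⊤ := by
      rw [lt_top_iff_ne_top]
      intro h
      refine hAI fun a ha => ?_
      have : (⟨a, ha⟩ : A) ∈ I.comap A.subtype := h ▸ Submodule.mem_top
      exact this
    have hcomm : ∀ T ∈ Set.range (leftAct hA), ∀ T' ∈ Set.range (leftAct hA), Commute T T' := by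
      rintro _ ⟨a, rfl⟩ _ ⟨b, rfl⟩
      rw [commute_iff_eq, ← sub_eq_zero, ← leftAct_mul]
      ext x
      exact hab _ (hL a b) _ x.2
    have hinv : ∀ T ∈ Set.range (leftAct hA), ∀ w ∈ I.comap A.subtype,
        T w ∈ I.comap A.subtype := by
      rintro _ ⟨a, rfl⟩ w hw
      exact (hI a w hw).1
    obtain ⟨v, -, hv, hT⟩ := exists_common_eigenvector_mod hcomm
      (fun _ _ _ _ => Submodule.mem_top) hinv hlt
    refine ⟨v, hv, fun a => ?_⟩
    have hav : a * v ∈ I ⊔ F ∙ (v : L) := by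
      obtain ⟨c, hc⟩ := hT _ ⟨a, rfl⟩
      have hc' : a * (v : L) - c • (v : L) ∈ I := hc
      rw [← sub_add_cancel (a * (v : L)) (c • (v : L))]
      exact Submodule.add_mem_sup hc' (Submodule.smul_mem _ _
        (Submodule.mem_span_singleton_self _))
    refine ⟨hav, ?_⟩
    rcases hr v v.2 a with h | h <;> rw [h]
    · exact zero_mem _
    · exact neg_mem hav

instance isLeibniz_subalgebra (K : NonUnitalSubalgebra F L) [IsLeibniz L] : IsLeibniz K :=
  ⟨fun a b c => Subtype.ext (IsLeibniz.leibniz (a : L) b c)⟩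

instance finiteDimensional_subalgebra (K : NonUnitalSubalgebra F L) [FiniteDimensional F L] :
    FiniteDimensional F K :=
  inferInstanceAs (FiniteDimensional F K.toSubmodule)

/-- A supersolvable complement and a one-dimensional ideal give a supersolvable algebra. -/
theorem IsSplit.isSupersolvable [FiniteDimensional F L] {A : Submodule F L}
    {M : NonUnitalSubalgebra F L} (h : IsSplit A M) (hA : Module.finrank F A = 1)
    (hM : IsSupersolvable F M) : IsSupersolvable F L := by
  obtain ⟨n, I, h0, hn, hle, hI⟩ := hM
  let ι : M →ₗ[F] L := M.toSubmodule.subtype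
  let G : ℕ → Submodule F L := fun i => A ⊔ (I i).map ι
  have hG : ∀ i ≤ n, IsIdeal (G i) := by
    intro i hi l x hx
    obtain ⟨a, ha, y, hy, rfl⟩ := Submodule.mem_sup.1 hx
    obtain ⟨m, hm, rfl⟩ := hy
    obtain ⟨b, hb, k, hk, rfl⟩ := h.exists_add l
    have h1 := (hI i hi).1 ⟨k, hk⟩ m hm
    have h2 : k * ι m ∈ (I i).map ι := ⟨_, h1.1, rfl⟩
    have h3 : ι m * k ∈ (I i).map ι := ⟨_, h1.2, rfl⟩
    rw [mul_add, add_mul _ _ (ι m), add_mul a, mul_add (ι m)]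
    exact ⟨add_mem (Submodule.mem_sup_left (h.isIdeal _ a ha).1)
        (Submodule.add_mem_sup (h.isIdeal _ b hb).2 h2),
      add_mem (Submodule.mem_sup_left (h.isIdeal _ a ha).2)
        (Submodule.add_mem_sup (h.isIdeal _ b hb).1 h3)⟩
  have hGf : ∀ i ≤ n, Module.finrank F (G i) = i + 1 := by
    intro i hi
    have h1 := Submodule.finrank_sup_add_finrank_inf_eq A ((I i).map ι)
    have h2 : A ⊓ (I i).map ι = ⊥ := by
      rw [eq_bot_iff]
      rintro _ ⟨hx, m, -, rfl⟩
      exact h.eq_zero _ hx m.2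
    have h3 : Module.finrank F ((I i).map ι) = i :=
      (Submodule.finrank_map_subtype_eq M.toSubmodule (I i)).trans (hI i hi).2
    rw [h2, finrank_bot, hA, h3] at h1
    exact h1.trans (add_comm 1 i)
  -- The chain is shifted by one: `A` itself takes dimension one, and the term built from `I i` has
  -- index `i + 1`.
  refine ⟨n + 1, fun i => Nat.casesOn i ⊥ G, rfl, ?_, ?_, ?_⟩
  · rw [eq_top_iff]
    intro l _
    obtain ⟨a, ha, k, hk, rfl⟩ := h.exists_add l
    refine Submodule.add_mem_sup ha ⟨⟨k, hk⟩, ?_, rfl⟩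
    rw [hn]
    exact Submodule.mem_top
  · rintro (_ | i) hi
    · exact bot_le
    · exact sup_le_sup_left (Submodule.map_mono (hle i (by omega))) A
  · rintro (_ | i) hi
    · exact ⟨isIdeal_bot, finrank_bot F L⟩
    · exact ⟨hG i (by omega), hGf i (by omega)⟩

end Structure

/-! ### Classification of the critical splittings. -/

section Critical

variable {F : Type*} [Field F] {L : Type*} [NonUnitalNonAssocRing L] [Module F L]
  [IsScalarTower F L L] [SMulCommClass F L L]

/-- A splitting `L = A + M` where `M` is a Lie algebra acting faithfully and irreducibly on the
unique minimal ideal `A`, and every proper subalgebra of `M` has an eigenvector in `A`. -/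
structure IsCritical (A : Submodule F L) (M : NonUnitalSubalgebra F L) : Prop
    extends IsSplit A M where
  minimal : IsUniqueMinimalIdeal A
  finrank_ne_one : Module.finrank F A ≠ 1
  faithful : ∀ m ∈ M, (∀ a ∈ A, m * a = 0) → m = 0
  irreducible : ∀ W : Submodule F A, (∀ m ∈ M, ∀ w ∈ W, leftAct isIdeal m w ∈ W) → W = ⊥ ∨ W = ⊤
  alternating : ∀ m ∈ M, m * m = 0
  eigenvector : ∀ S ≤ M.toSubmodule, (∀ a ∈ S, ∀ b ∈ S, a * b ∈ S) → S ≠ M.toSubmodule →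
    ∃ v ∈ A, v ≠ 0 ∧ ∀ s ∈ S, ∃ c : F, s * v = c • v
  isLie_or : IsLie L ∨ A = leib F L

namespace IsCritical

variable {A : Submodule F L} {M : NonUnitalSubalgebra F L}

theorem antisymm (h : IsCritical A M) {m k : L} (hm : m ∈ M) (hk : k ∈ M) : m * k = -(k * m) := by
  have := h.alternating _ (add_mem hm hk)
  rw [mul_add, add_mul, add_mul, h.alternating m hm, h.alternating k hk, zero_add, add_zero,
    add_comm] at this
  exact eq_neg_of_add_eq_zero_left this

theorem nontrivial (h : IsCritical A M) : Nontrivial A :=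
  Submodule.nontrivial_iff_ne_bot.2 h.minimal.1.2.1

theorem irreducible_of_span (h : IsCritical A M) {s : Set L}
    (hs : M.toSubmodule ≤ Submodule.span F s) (W : Submodule F A)
    (hW : ∀ m ∈ s, ∀ w ∈ W, leftAct h.isIdeal m w ∈ W) : W = ⊥ ∨ W = ⊤ := by
  refine h.irreducible W fun m hm w hw => ?_
  replace hm := hs hm
  induction hm using Submodule.span_induction with
  | mem m hm => exact hW m hm w hw
  | zero => simp
  | add a b _ _ ha hb => rw [map_add]; exact add_mem ha hb
  | smul c a _ ha => rw [map_smul]; exact Submodule.smul_mem _ _ ha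

/-- On a common eigenvector `x` and `y` act as commuting scalars. This is what prevents a proper
subalgebra from containing two elements whose product acts injectively. -/
theorem eq_of_eigenvalues [IsLeibniz L] {x y v : L} {α β : F} (hx : x * v = α • v)
    (hy : y * v = β • v) : (x * y) * v = 0 := by
  rw [mul_mul_eq_sub, hy, hx, mul_smul_comm, mul_smul_comm, hx, hy, smul_comm, sub_self]

/-- The line through a common eigenvector is invariant, so irreducibility would make `A`
one-dimensional. -/
theorem not_scalar (h : IsCritical A M) {v : A} (hv0 : v ≠ 0)
    (hv : ∀ m ∈ M, ∃ c : F, leftAct h.isIdeal m v = c • v) : False := by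
  have hinv : ∀ m ∈ M, ∀ w ∈ F ∙ v, leftAct h.isIdeal m w ∈ F ∙ v := by
    intro m hm w hw
    obtain ⟨r, rfl⟩ := Submodule.mem_span_singleton.1 hw
    obtain ⟨c, hc⟩ := hv m hm
    rw [map_smul, hc]
    exact Submodule.smul_mem _ _ (Submodule.smul_mem _ _ (Submodule.mem_span_singleton_self v))
  rcases h.irreducible (F ∙ v) hinv with h' | h'
  · exact hv0 (Submodule.span_singleton_eq_bot.1 h')
  · refine h.finrank_ne_one ?_
    rw [← finrank_top, ← h', finrank_span_singleton hv0]

theorem linearIndependent_of_mul_eq_left {x y : L} (hxy : x * y = x) (hxx : x * x = 0)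
    (hx : x ≠ 0) : LinearIndependent F ![x, y] := by
  rw [LinearIndependent.pair_iff]
  intro α β hαβ
  have h1 := congrArg (fun l => x * l) hαβ
  simp only [mul_add, mul_smul_comm, mul_zero, hxy, hxx, smul_zero, zero_add] at h1
  have hβ := (smul_eq_zero.1 h1).resolve_right hx
  rw [hβ, zero_smul, add_zero] at hαβ
  exact ⟨(smul_eq_zero.1 hαβ).resolve_right hx, hβ⟩

theorem linearIndependent_of_mul_eq_central {x y z : L} (hxy : x * y = z) (hxx : x * x = 0)
    (hxz : x * z = 0) (hzy : z * y = 0) (hz : z ≠ 0) : LinearIndependent F ![x, y, z] := by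
  rw [Fintype.linearIndependent_iff]
  intro g hg
  rw [Fin.sum_univ_three] at hg
  simp only [Matrix.cons_val] at hg
  have h1 := congrArg (fun l => x * l) hg
  simp only [mul_add, mul_smul_comm, mul_zero, hxy, hxz, hxx, smul_zero, zero_add,
    add_zero] at h1
  have hg1 := (smul_eq_zero.1 h1).resolve_right hz
  rw [hg1, zero_smul, add_zero] at hg
  have h2 := congrArg (fun l => l * y) hg
  simp only [add_mul, smul_mul_assoc, zero_mul, hxy, hzy, smul_zero, add_zero] at h2
  have hg0 := (smul_eq_zero.1 h2).resolve_right hz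
  rw [hg0, zero_smul, zero_add] at hg
  have hg2 := (smul_eq_zero.1 hg).resolve_right hz
  intro i
  fin_cases i
  · exact hg0
  · exact hg1
  · exact hg2

theorem basis_of_split {A : Submodule F L} {M : NonUnitalSubalgebra F L} (h : IsSplit A M)
    {ι κ : Type*} {f : ι → A} (hf : LinearIndependent F f)
    (hfs : Submodule.span F (Set.range f) = ⊤) {b : κ → L} (hb : LinearIndependent F b)
    (hbs : Submodule.span F (Set.range b) = M.toSubmodule) :
    Submodule.span F (Set.range fun i => (f i : L)) = A ∧
    LinearIndependent F (Sum.elim (fun i => (f i : L)) b) ∧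
    Submodule.span F (Set.range (Sum.elim (fun i => (f i : L)) b)) = ⊤ := by
  have hA : Submodule.span F (Set.range fun i => (f i : L)) = A := by
    have := congrArg (Submodule.map A.subtype) hfs
    rwa [Submodule.map_span, Submodule.map_top, Submodule.range_subtype, ← Set.range_comp] at this
  refine ⟨hA, ?_, ?_⟩
  · rw [linearIndependent_sum]
    refine ⟨hf.map' A.subtype (Submodule.ker_subtype A), hb, ?_⟩
    change Disjoint (Submodule.span F (Set.range fun i => (f i : L)))
      (Submodule.span F (Set.range b))
    rw [hA, hbs, Submodule.disjoint_def]
    exact fun a ha hm => h.eq_zero a ha hm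
  · rw [Set.Sum.elim_range, Submodule.span_union, hA, hbs, eq_top_iff]
    intro l _
    obtain ⟨a, ha, m, hm, rfl⟩ := h.exists_add l
    exact Submodule.add_mem_sup ha hm

variable [IsAlgClosed F] [FiniteDimensional F L] [IsLeibniz L]

/-- Here `x` acts invertibly on `A`, and cancelling it from `[x, y] = x` shows that `x` and `x⁻¹y`
satisfy the canonical commutation relation as operators. -/
theorem exists_isTypeA (h : IsCritical A M) {x y : L} (hx : x ∈ M) (hy : y ∈ M) (hxy : x * y = x)
    (hx0 : x ≠ 0) (hid : ∀ m ∈ M, ∃ r : F, x * m = r • x) :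
    ∃ p : ℕ, p.Prime ∧ CharP F p ∧ IsTypeA F L p := by
  have := h.nontrivial
  set ρ := leftAct h.isIdeal with hρ
  -- From `x(mw) = (xm)w + m(xw)` and `xm ∈ Fx`, the kernel is invariant under `M`; it is not all of
  -- `A` by faithfulness.
  have hker : LinearMap.ker (ρ x) = ⊥ := by
    refine (h.irreducible _ fun m hm w hw => ?_).resolve_right fun hT => hx0 ?_
    · rw [LinearMap.mem_ker] at hw ⊢
      obtain ⟨r, hr⟩ := hid m hm
      have h1 := LinearMap.congr_fun (leftAct_mul h.isIdeal x m) w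
      rw [hr, map_smul, LinearMap.smul_apply, LinearMap.sub_apply, Module.End.mul_apply,
        Module.End.mul_apply, ← hρ, hw, map_zero, smul_zero, sub_zero] at h1
      exact h1.symm
    · refine h.faithful x hx fun a ha => ?_
      have : (⟨a, ha⟩ : A) ∈ LinearMap.ker (ρ x) := hT ▸ Submodule.mem_top
      exact congrArg Subtype.val (LinearMap.mem_ker.1 this)
  have hinj : ∀ v ∈ A, x * v = 0 → v = 0 := by
    intro v hv hxv
    have : (⟨v, hv⟩ : A) ∈ LinearMap.ker (ρ x) := LinearMap.mem_ker.2 (Subtype.ext hxv)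
    rw [hker, Submodule.mem_bot] at this
    exact congrArg Subtype.val this
  have hgen : ∀ x' ∈ M, ∀ y' ∈ M, x' * y' = x' → (∀ v ∈ A, x' * v = 0 → v = 0) →
      Submodule.span F {x', y'} = M.toSubmodule := by
    intro x' hx' y' hy' hxy' hinj'
    by_contra hne
    have hmul : ∀ a ∈ Submodule.span F {x', y'}, ∀ b ∈ Submodule.span F {x', y'},
        a * b ∈ Submodule.span F {x', y'} := by
      intro a ha b hb
      obtain ⟨a₁, a₂, rfl⟩ := Submodule.mem_span_pair.1 ha
      obtain ⟨b₁, b₂, rfl⟩ := Submodule.mem_span_pair.1 hb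
      have : (a₁ • x' + a₂ • y') * (b₁ • x' + b₂ • y') = (a₁ * b₂ - a₂ * b₁) • x' := by
        simp only [mul_add, add_mul, mul_smul_comm, smul_mul_assoc, hxy',
          h.antisymm hy' hx', h.alternating _ hx', h.alternating _ hy']
        module
      rw [this]
      exact Submodule.smul_mem _ _ (Submodule.subset_span (by simp))
    obtain ⟨v, hv, hv0, hev⟩ := h.eigenvector (Submodule.span F {x', y'})
      (Submodule.span_le.2 (by rintro _ (rfl | rfl) <;> assumption)) hmul hne
    obtain ⟨α, hα⟩ := hev x' (Submodule.subset_span (by simp))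
    obtain ⟨β, hβ⟩ := hev y' (Submodule.subset_span (by simp))
    refine hv0 (hinj' v hv ?_)
    rw [← hxy']
    exact eq_of_eigenvalues hα hβ
  obtain ⟨Y₀, hY₀⟩ : ∃ Y₀, ρ x * Y₀ = ρ y := by
    have hs : Function.Surjective (ρ x) :=
      LinearMap.injective_iff_surjective.1 (LinearMap.ker_eq_bot.1 hker)
    obtain ⟨g, hg⟩ := (ρ x).exists_rightInverse_of_surjective (LinearMap.range_eq_top.2 hs)
    refine ⟨g * ρ y, ?_⟩
    have hg' : ρ x * g = 1 := hg
    rw [← mul_assoc, hg', one_mul]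
  have hcan : ∀ T : Module.End F A, ρ x * T = 0 → T = 0 := by
    intro T hT
    ext v
    have : T v ∈ LinearMap.ker (ρ x) := LinearMap.congr_fun hT v
    rw [hker, Submodule.mem_bot] at this
    simp [this]
  have hcomm : ρ x * Y₀ - Y₀ * ρ x = 1 := by
    rw [← sub_eq_zero]
    refine hcan _ ?_
    have h1 := leftAct_mul h.isIdeal x y
    rw [hxy, ← hρ, ← hY₀] at h1
    rw [mul_sub, mul_sub, mul_one, ← mul_assoc (ρ x) Y₀, ← h1, sub_self]
  obtain ⟨p, hp, hchar⟩ := exists_charP_of_commutator_eq_one hcomm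
  have : Fact p.Prime := ⟨hp⟩
  have hpY := commute_pow_char (p := p) hcomm
  obtain ⟨c, hc⟩ := exists_eq_smul_one_of_commute (S := ρ '' {x, y}) (Z := ρ x ^ p)
    (fun W hW => h.irreducible_of_span (hgen x hx y hy hxy hinj).ge W
      fun m hm => hW _ ⟨m, hm, rfl⟩) (by
      rintro _ ⟨m, rfl | rfl, rfl⟩
      · exact (Commute.refl _).pow_right p
      · rw [← hY₀]
        exact ((Commute.refl _).pow_right p).mul_left hpY.symm)
  have hc0 : c ≠ 0 := by
    rintro rfl
    rw [zero_smul] at hc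
    have : ∀ n, ρ x ^ n ≠ 0 := by
      intro n
      induction n with
      | zero => simp
      | succ n ih =>
        rw [pow_succ']
        exact fun h => ih (hcan _ h)
    exact this p hc
  -- Chosen so that `(t x) ^ p = t ^ p c = -1` on `A`.
  obtain ⟨t, ht⟩ := IsAlgClosed.exists_pow_nat_eq (-c⁻¹) hp.pos
  have ht0 : t ≠ 0 := by
    rintro rfl
    rw [zero_pow hp.ne_zero, eq_comm, neg_eq_zero] at ht
    exact inv_ne_zero hc0 ht
  obtain ⟨μ, hμ⟩ := Module.End.exists_eigenvalue (t⁻¹ • Y₀)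
  obtain ⟨u, hu⟩ := hμ.exists_hasEigenvector
  -- The factor `t⁻¹` preserves the commutation relation with `t x`, and subtracting the eigenvalue
  -- makes `Y` kill `u`. Then `(t x) Y` is the action of `y - μ t x`, which explains the new `y`.
  let Y : Module.End F A := t⁻¹ • Y₀ - μ • 1
  have hYu : Y u = 0 := by
    simp only [Y, LinearMap.sub_apply, Module.End.mem_eigenspace_iff.1 hu.1]
    simp
  have hXY : ρ (t • x) * Y - Y * ρ (t • x) = 1 := by
    rw [map_smul, ← hcomm]
    simp only [Y, mul_sub, sub_mul, smul_mul_smul_comm, mul_inv_cancel₀ ht0, inv_mul_cancel₀ ht0,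
      mul_one, one_mul, one_smul, mul_comm μ t]
    abel
  have hXp : ρ (t • x) ^ p = -1 := by
    rw [map_smul, smul_pow, hc, ht, smul_smul, neg_mul, inv_mul_cancel₀ hc0, neg_smul, one_smul]
  have hx' : t • x ∈ M := SMulMemClass.smul_mem t hx
  have hy' : y - μ • t • x ∈ M := sub_mem hy (SMulMemClass.smul_mem μ hx')
  have hxx := h.alternating x hx
  have hxy' : (t • x) * (y - μ • t • x) = t • x := by
    rw [mul_sub, mul_smul_comm, mul_smul_comm, smul_mul_assoc, smul_mul_assoc, hxy, hxx]
    simp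
  have hyρ : ρ (y - μ • t • x) = ρ (t • x) * Y := by
    simp only [Y, map_sub, map_smul, mul_sub, smul_mul_smul_comm, mul_inv_cancel₀ ht0, hY₀,
      one_smul, mul_one, smul_smul, mul_comm μ t]
  have hspan := hgen _ hx' _ hy' hxy' fun v hv hv' => hinj v hv (by
    rw [smul_mul_assoc] at hv'
    exact (smul_eq_zero.1 hv').resolve_left ht0)
  obtain ⟨f, hf, hfs, hfX, hfY⟩ := exists_cyclic_basis hXY hXp hu.2 hYu fun W hW =>
    h.irreducible_of_span hspan.ge W (by
      rintro _ (rfl | rfl) w hw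
      · exact (hW w hw).1
      · rw [← hρ, hyρ]
        exact (hW _ (hW w hw).2).1)
  have hb := linearIndependent_of_mul_eq_left (F := F) hxy' (h.alternating _ hx')
    (smul_ne_zero ht0 hx0)
  obtain ⟨hA, hli, hsp⟩ := basis_of_split h.toIsSplit hf hfs hb
    (by rw [Matrix.range_cons, Matrix.range_cons, Matrix.range_empty, Set.union_empty]; exact hspan)
  refine ⟨p, hp, hchar, fun i => f i, t • x, y - μ • t • x, hli, hsp, hA.symm ▸ h.minimal,
    fun i j => h.mul_eq_zero _ (f i).2 _ (f j).2, fun i => ?_, fun i => ?_, hxy', ?_,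
    h.alternating _ hx', h.alternating _ hy', hA.symm ▸ h.isLie_or⟩
  · exact congrArg Subtype.val (hfX i)
  · have h1 : ρ (y - μ • t • x) (f i) = -((i.val : F) • f i) := by
      rw [hyρ, Module.End.mul_apply, hfY, map_smul, hfX, sub_add_cancel, smul_neg]
    exact congrArg Subtype.val h1
  · rw [h.antisymm hy' hx', hxy']

/-- Since `z` acts as the identity, `x` and `y` themselves satisfy the canonical commutation
relation, and adding multiples of `z` shifts them by scalars. -/
theorem exists_isTypeB (h : IsCritical A M) {x y z : L} (hx : x ∈ M) (hy : y ∈ M) (hz : z ∈ M)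
    (hxy : x * y = z) (hzM : ∀ m ∈ M, z * m = 0) (hzA : ∀ a ∈ A, z * a = a) :
    ∃ p : ℕ, p.Prime ∧ CharP F p ∧ IsTypeB F L p := by
  have := h.nontrivial
  set ρ := leftAct h.isIdeal with hρ
  have hMz : ∀ m ∈ M, m * z = 0 := fun m hm => by rw [h.antisymm hm hz, hzM m hm, neg_zero]
  have hρz : ρ z = 1 := by
    ext a
    exact hzA a a.2
  have hz0 : z ≠ 0 := by
    rintro rfl
    rw [map_zero] at hρz
    exact zero_ne_one hρz
  have hgen : ∀ x' ∈ M, ∀ y' ∈ M, x' * y' = z →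
      Submodule.span F {x', y', z} = M.toSubmodule := by
    intro x' hx' y' hy' hxy'
    by_contra hne
    have hmul : ∀ a ∈ Submodule.span F {x', y', z}, ∀ b ∈ Submodule.span F {x', y', z},
        a * b ∈ Submodule.span F {x', y', z} := by
      intro a ha b hb
      obtain ⟨a₁, a₂, a₃, rfl⟩ := Submodule.mem_span_triple.1 ha
      obtain ⟨b₁, b₂, b₃, rfl⟩ := Submodule.mem_span_triple.1 hb
      have : (a₁ • x' + a₂ • y' + a₃ • z) * (b₁ • x' + b₂ • y' + b₃ • z) =
          (a₁ * b₂ - a₂ * b₁) • z := by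
        simp only [mul_add, add_mul, mul_smul_comm, smul_mul_assoc, hxy',
          h.antisymm hy' hx', h.alternating _ hx', h.alternating _ hy', hMz _ hx', hMz _ hy',
          hMz _ hz, hzM _ hx', hzM _ hy']
        module
      rw [this]
      exact Submodule.smul_mem _ _ (Submodule.subset_span (by simp))
    obtain ⟨v, hv, hv0, hev⟩ := h.eigenvector (Submodule.span F {x', y', z})
      (Submodule.span_le.2 (by rintro _ (rfl | rfl | rfl) <;> assumption)) hmul hne
    obtain ⟨α, hα⟩ := hev x' (Submodule.subset_span (by simp))
    obtain ⟨β, hβ⟩ := hev y' (Submodule.subset_span (by simp))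
    refine hv0 ?_
    rw [← hzA v hv, ← hxy']
    exact eq_of_eigenvalues hα hβ
  have hcomm : ρ x * ρ y - ρ y * ρ x = 1 := by
    rw [← hρz, ← hxy]
    exact (leftAct_mul h.isIdeal x y).symm
  obtain ⟨p, hp, hchar⟩ := exists_charP_of_commutator_eq_one hcomm
  have : Fact p.Prime := ⟨hp⟩
  have hpY := commute_pow_char (p := p) hcomm
  obtain ⟨c, hc⟩ := exists_eq_smul_one_of_commute (S := ρ '' {x, y, z}) (Z := ρ x ^ p)
    (fun W hW => h.irreducible_of_span (hgen x hx y hy hxy).ge W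
      fun m hm => hW _ ⟨m, hm, rfl⟩) (by
      rintro _ ⟨m, rfl | rfl | rfl, rfl⟩
      · exact (Commute.refl _).pow_right p
      · exact hpY.symm
      · rw [hρz]
        exact Commute.one_left _)
  -- In characteristic `p`, `(x + t z) ^ p` acts as `c + t ^ p`, which is to be `-1`.
  obtain ⟨t, ht⟩ := IsAlgClosed.exists_pow_nat_eq (-1 - c) hp.pos
  obtain ⟨μ, hμ⟩ := Module.End.exists_eigenvalue (ρ y)
  obtain ⟨u, hu⟩ := hμ.exists_hasEigenvector
  have hx' : x + t • z ∈ M := add_mem hx (SMulMemClass.smul_mem t hz)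
  have hy' : y - μ • z ∈ M := sub_mem hy (SMulMemClass.smul_mem μ hz)
  have hxy' : (x + t • z) * (y - μ • z) = z := by
    rw [mul_sub, mul_smul_comm, hMz _ hx', add_mul, smul_mul_assoc, hzM y hy, hxy]
    simp
  have hYu : ρ (y - μ • z) u = 0 := by
    rw [map_sub, map_smul, hρz, LinearMap.sub_apply, Module.End.mem_eigenspace_iff.1 hu.1]
    simp
  have hXY : ρ (x + t • z) * ρ (y - μ • z) - ρ (y - μ • z) * ρ (x + t • z) = 1 := by
    have h1 := leftAct_mul h.isIdeal (x + t • z) (y - μ • z)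
    rw [hxy', ← hρ, hρz] at h1
    exact h1.symm
  have hXp : ρ (x + t • z) ^ p = -1 := by
    have : CharP (Module.End F A) p := charP_of_injective_algebraMap
      (algebraMap F (Module.End F A)).injective p
    rw [map_add, map_smul, hρz, add_pow_char_of_commute p ((Commute.one_right _).smul_right t),
      hc, smul_pow, ht, one_pow, ← add_smul]
    simp
  have hspan := hgen _ hx' _ hy' hxy'
  obtain ⟨f, hf, hfs, hfX, hfY⟩ := exists_cyclic_basis hXY hXp hu.2 hYu fun W hW =>
    h.irreducible_of_span hspan.ge W (by
      rintro _ (rfl | rfl | rfl) w hw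
      · exact (hW w hw).1
      · exact (hW w hw).2
      · rw [← hρ, hρz]
        exact hw)
  have hb := linearIndependent_of_mul_eq_central (F := F) hxy' (h.alternating _ hx') (hMz _ hx')
    (hzM _ hy') hz0
  -- Shifting the index turns the coefficient `i` of the cyclic basis into the `i + 1` of the second
  -- type.
  have hf' : LinearIndependent F fun i => f (i + 1) :=
    hf.comp (fun i => i + 1) (add_left_injective 1)
  have hfs' : Submodule.span F (Set.range fun i => f (i + 1)) = ⊤ := by
    rw [← hfs]
    congr 1
    exact (Equiv.addRight (1 : ZMod p)).surjective.range_comp f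
  obtain ⟨hA, hli, hsp⟩ := basis_of_split h.toIsSplit hf' hfs' hb (by
    rw [Matrix.range_cons, Matrix.range_cons, Matrix.range_cons, Matrix.range_empty,
      Set.union_empty]
    exact hspan)
  refine ⟨p, hp, hchar, fun i => f (i + 1), x + t • z, y - μ • z, z, hli, hsp,
    hA.symm ▸ h.minimal, fun i j => h.mul_eq_zero _ (f _).2 _ (f _).2, fun i => ?_, fun i => ?_,
    fun i => hzA _ (f _).2, hxy', ?_, h.alternating _ hx', h.alternating _ hy',
    h.alternating _ hz, hMz _ hx', hzM _ hx', hMz _ hy', hzM _ hy', hA.symm ▸ h.isLie_or⟩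
  · exact congrArg Subtype.val (hfX (i + 1))
  · have h1 : ρ (y - μ • z) (f (i + 1)) = ((i.val : F) + 1) • f (i - 1 + 1) := by
      have : NeZero p := ⟨hp.ne_zero⟩
      have h2 : (((i + 1 : ZMod p).val : ℕ) : F) = (i.val : F) + 1 := by
        rw [ZMod.natCast_val, ZMod.natCast_val, ZMod.cast_add (dvd_refl p),
          ZMod.cast_one (dvd_refl p)]
      rw [hfY, h2, add_sub_cancel_right, sub_add_cancel]
    exact congrArg Subtype.val h1
  · rw [h.antisymm hy' hx', hxy']

/-- If `z` is not central, rescaling gives `xy = x`. Otherwise `z` acts as a nonzero scalar, and the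
products of `w` produce either a Heisenberg pair or an element `x` with `xy = x`. -/
theorem exists_type_of_flag (h : IsCritical A M) {z w : L} (hz : z ∈ M) (hw : w ∈ M)
    (hz0 : z ≠ 0) (hzM : ∀ m ∈ M, ∃ r : F, z * m = r • z)
    (hwM : ∀ m ∈ M, ∃ r s : F, w * m = r • w + s • z) (hwz : ∀ r : F, w ≠ r • z) :
    ∃ p : ℕ, p.Prime ∧ CharP F p ∧ (IsTypeA F L p ∨ IsTypeB F L p) := by
  have := h.nontrivial
  have typeA : ∀ x ∈ M, ∀ y ∈ M, x * y = x → x ≠ 0 → (∀ m ∈ M, ∃ r : F, x * m = r • x) →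
      ∃ p : ℕ, p.Prime ∧ CharP F p ∧ (IsTypeA F L p ∨ IsTypeB F L p) := by
    intro x hx y hy hxy hx0 hid
    obtain ⟨p, hp, hc, ht⟩ := h.exists_isTypeA hx hy hxy hx0 hid
    exact ⟨p, hp, hc, Or.inl ht⟩
  by_cases hcen : ∀ m ∈ M, z * m = 0
  swap
  · push Not at hcen
    obtain ⟨m, hm, hne⟩ := hcen
    obtain ⟨r, hr⟩ := hzM m hm
    have hr0 : r ≠ 0 := by
      rintro rfl
      exact hne (by rw [hr, zero_smul])
    refine typeA z hz (r⁻¹ • m) (SMulMemClass.smul_mem _ hm) ?_ hz0 hzM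
    rw [mul_smul_comm, hr, inv_smul_smul₀ hr0]
  have scalar : ∀ k ∈ M, (∀ m ∈ M, k * m = 0) → ∃ c : F, leftAct h.isIdeal k = c • 1 := by
    intro k _ hkM
    refine exists_eq_smul_one_of_commute (S := leftAct h.isIdeal '' M)
      (fun W hW => h.irreducible W fun m hm => hW _ ⟨m, hm, rfl⟩) ?_
    rintro _ ⟨m, hm, rfl⟩
    refine (commute_iff_eq _ _).2 (sub_eq_zero.1 ?_).symm
    rw [← leftAct_mul, hkM m hm, map_zero]
  obtain ⟨c, hc⟩ := scalar z hz hcen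
  have hcA : ∀ a ∈ A, z * a = c • a := fun a ha =>
    congrArg Subtype.val (LinearMap.congr_fun hc ⟨a, ha⟩)
  have hc0 : c ≠ 0 := by
    rintro rfl
    exact hz0 (h.faithful z hz fun a ha => by rw [hcA a ha, zero_smul])
  have typeB : ∀ x ∈ M, ∀ y ∈ M, ∀ r : F, r ≠ 0 → x * y = r • z →
      ∃ p : ℕ, p.Prime ∧ CharP F p ∧ (IsTypeA F L p ∨ IsTypeB F L p) := by
    intro x hx y hy r hr hxy
    obtain ⟨p, hp, hc, ht⟩ := h.exists_isTypeB (x := (c⁻¹ * r⁻¹) • x) (y := y) (z := c⁻¹ • z)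
      (SMulMemClass.smul_mem _ hx) hy (SMulMemClass.smul_mem _ hz)
      (by rw [smul_mul_assoc, hxy, smul_smul, mul_assoc, inv_mul_cancel₀ hr, mul_one])
      (fun m hm => by rw [smul_mul_assoc, hcen m hm, smul_zero])
      (fun a ha => by rw [smul_mul_assoc, hcA a ha, inv_smul_smul₀ hc0])
    exact ⟨p, hp, hc, Or.inr ht⟩
  -- A central `w` would act as a scalar too, and faithfulness would make it a multiple of `z`.
  obtain ⟨m, hm, hwm⟩ : ∃ m ∈ M, w * m ≠ 0 := by
    by_contra! hcon
    obtain ⟨d, hd⟩ := scalar w hw hcon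
    refine hwz (d * c⁻¹) (sub_eq_zero.1 (h.faithful _ (sub_mem hw (SMulMemClass.smul_mem _ hz)) ?_))
    intro a ha
    have : w * a = d • a := congrArg Subtype.val (LinearMap.congr_fun hd ⟨a, ha⟩)
    rw [sub_mul, this, smul_mul_assoc, hcA a ha, smul_smul, mul_assoc, inv_mul_cancel₀ hc0,
      mul_one, sub_self]
  obtain ⟨α, β, hαβ⟩ := hwM m hm
  by_cases hα : α = 0
  · rw [hα, zero_smul, zero_add] at hαβ
    refine typeB w hw m hm β ?_ hαβ
    rintro rfl
    exact hwm (by rw [hαβ, zero_smul])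
  set x := w * m with hxdef
  have hx : x ∈ M := M.mul_mem hw hm
  have hy : α⁻¹ • m ∈ M := SMulMemClass.smul_mem _ hm
  have hxmul : ∀ k ∈ M, x * k = α • (w * k) := by
    intro k hk
    rw [hαβ, add_mul, smul_mul_assoc, smul_mul_assoc, hcen k hk, smul_zero, add_zero]
  have hxy : x * (α⁻¹ • m) = x := by
    rw [mul_smul_comm, hxmul m hm, inv_smul_smul₀ hα]
  -- If `x` does not span an ideal of `M`, some `b` gives `xb = r x + s z` with `s ≠ 0`; subtracting
  -- `r y`, where `xy = x`, leaves a Heisenberg pair.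
  by_cases hid : ∀ k ∈ M, ∃ r : F, x * k = r • x
  · exact typeA x hx _ hy hxy hwm hid
  push Not at hid
  obtain ⟨b, hb, hbx⟩ := hid
  obtain ⟨r, s, hrs⟩ := hwM b hb
  have hxb : x * b = r • x + (α * s - r * β) • z := by
    rw [hxmul b hb, hrs, hαβ]
    module
  refine typeB x hx (b - r • (α⁻¹ • m)) (sub_mem hb (SMulMemClass.smul_mem r hy)) (α * s - r * β) ?_ ?_
  · intro h0
    rw [h0, zero_smul, add_zero] at hxb
    exact hbx r hxb
  · rw [mul_sub, mul_smul_comm, hxy, hxb, add_sub_cancel_left]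

theorem exists_type (h : IsCritical A M) (hM : IsSupersolvable F M) :
    ∃ p : ℕ, p.Prime ∧ CharP F p ∧ (IsTypeA F L p ∨ IsTypeB F L p) := by
  have := h.nontrivial
  -- Otherwise `M` acts through multiples of a single operator, which has an eigenvector. So the
  -- flag of `M` has a second step.
  have hdim : ¬ Module.finrank F M ≤ 1 := by
    intro hle
    obtain ⟨z, hz⟩ := finrank_le_one_iff.1 hle
    obtain ⟨c, hc⟩ := Module.End.exists_eigenvalue (leftAct h.isIdeal (z : L))
    obtain ⟨v, hv⟩ := hc.exists_hasEigenvector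
    refine h.not_scalar hv.2 fun m hm => ?_
    obtain ⟨r, hr⟩ := hz ⟨m, hm⟩
    have hr' : m = r • (z : L) := (congrArg Subtype.val hr).symm
    exact ⟨r * c, by rw [hr', map_smul, LinearMap.smul_apply,
      Module.End.mem_eigenspace_iff.1 hv.1, smul_smul]⟩
  obtain ⟨n, I, h0, hn, hle, hI⟩ := hM
  have hn2 : 2 ≤ n := by
    have := (hI n le_rfl).2
    rw [hn, finrank_top] at this
    omega
  obtain ⟨hI1, hf1⟩ := hI 1 (by omega)
  obtain ⟨hI2, hf2⟩ := hI 2 hn2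
  have hI12 : I 1 ≤ I 2 := hle 1 (by omega)
  obtain ⟨z, hz, hz0⟩ := Submodule.exists_mem_ne_zero_of_ne_bot (p := I 1) (by
    intro hb
    rw [hb, finrank_bot] at hf1
    exact zero_ne_one hf1)
  obtain ⟨w, hw, hw1⟩ := SetLike.exists_of_lt (lt_of_le_of_ne hI12 (by
    intro hb
    rw [hb, hf2] at hf1
    omega))
  have key1 : ∀ k ∈ I 1, ∃ r : F, k = r • z := by
    intro k hk
    obtain ⟨r, hr⟩ := exists_smul_eq_of_finrank_eq_one hf1 (x := (⟨z, hz⟩ : I 1))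
      (by simpa using hz0) ⟨k, hk⟩
    exact ⟨r, (congrArg Subtype.val hr).symm⟩
  have hsup : I 1 ⊔ F ∙ w = I 2 :=
    Submodule.eq_of_le_of_finrank_eq
      (sup_le hI12 ((Submodule.span_singleton_le_iff_mem _ _).2 hw))
      (by rw [finrank_sup_span_singleton hw1, hf1, hf2])
  have key2 : ∀ k ∈ I 2, ∃ r s : F, k = r • w + s • z := by
    intro k hk
    rw [← hsup] at hk
    obtain ⟨a, ha, b, hb, rfl⟩ := Submodule.mem_sup.1 hk
    obtain ⟨s, rfl⟩ := key1 a ha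
    obtain ⟨r, rfl⟩ := Submodule.mem_span_singleton.1 hb
    exact ⟨r, s, add_comm _ _⟩
  refine h.exists_type_of_flag z.2 w.2 (by simpa using hz0) (fun m hm => ?_) (fun m hm => ?_) ?_
  · obtain ⟨r, hr⟩ := key1 _ (hI1 ⟨m, hm⟩ z hz).2
    exact ⟨r, congrArg Subtype.val hr⟩
  · obtain ⟨r, s, hr⟩ := key2 _ (hI2 ⟨m, hm⟩ w hw).2
    exact ⟨r, s, congrArg Subtype.val hr⟩
  · intro r hr
    refine hw1 ?_
    rw [show w = r • z from Subtype.ext hr]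
    exact Submodule.smul_mem _ _ hz

end IsCritical
end Critical

/-! ### From minimal non-supersolvability to a critical splitting. -/

section Forward

variable {F : Type*} [Field F] {L : Type*} [NonUnitalNonAssocRing L] [Module F L]
  [IsScalarTower F L L] [SMulCommClass F L L] [IsLeibniz L] [FiniteDimensional F L]

/-- φ-freeness supplies a maximal subalgebra `M` not containing `A`. By maximality `A + M = L`, and
then `A ∩ M` is an ideal properly inside `A`. -/
theorem IsMinimalIdeal.exists_isSplit {A : Submodule F L} (hA : IsMinimalIdeal A)
    (hs : IsSolvable F L) (hphi : IsPhiFree F L) :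
    ∃ M : NonUnitalSubalgebra F L, M ≠ ⊤ ∧ IsSplit A M := by
  have hab := hA.mul_eq_zero hs
  obtain ⟨M, hM, a, ha, haM⟩ : ∃ M : NonUnitalSubalgebra F L, IsCoatom M ∧
      ∃ a ∈ A, a ∉ M := by
    by_contra! hcon
    have h1 : A ≤ frattiniIdeal F L :=
      le_sSup ⟨hA.1, fun x hx => NonUnitalAlgebra.mem_sInf.2 fun M hM => hcon M hM x hx⟩
    rw [hphi] at h1
    exact hA.2.1 (le_bot_iff.1 h1)
  let K : NonUnitalSubalgebra F L := (A ⊔ M.toSubmodule).toNonUnitalSubalgebra (by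
    intro x y hx hy
    obtain ⟨b, hb, m, hm, rfl⟩ := Submodule.mem_sup.1 hx
    obtain ⟨c, hc, k, hk, rfl⟩ := Submodule.mem_sup.1 hy
    rw [mul_add, add_mul _ _ k, ← add_assoc]
    exact Submodule.add_mem_sup (add_mem (hA.1 _ c hc).1 (hA.1 k b hb).2) (M.mul_mem hm hk))
  have hK : K = ⊤ := hM.2 K (SetLike.lt_iff_le_and_exists.2
    ⟨fun m hm => Submodule.mem_sup_right (S := A) (T := M.toSubmodule) hm, a, Submodule.mem_sup_left ha, haM⟩)
  have hadd : ∀ l, ∃ a ∈ A, ∃ m ∈ M, l = a + m := by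
    intro l
    have hl : l ∈ K := hK ▸ trivial
    obtain ⟨b, hb, m, hm, h⟩ := Submodule.mem_sup.1 hl
    exact ⟨b, hb, m, hm, h.symm⟩
  refine ⟨M, hM.1, hA.1, hab, hA.mul_eq_zero_or, fun b hb hbM => ?_, hadd⟩
  rcases hA.2.2 _ (isIdeal_inf_of_add_eq hA.1 hab hadd) inf_le_right with h | h
  · rw [← Submodule.mem_bot F, ← h]
    exact ⟨hbM, hb⟩
  · exact absurd (inf_eq_right.1 h ha) haM

/-- A second minimal ideal of an algebra `A + M` with `M` supersolvable is one-dimensional. -/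
theorem IsSplit.finrank_eq_one_of_ne {A A' : Submodule F L} {M : NonUnitalSubalgebra F L}
    (h : IsSplit A M) (hM : IsSupersolvable F M) (hA : IsMinimalIdeal A)
    (hA' : IsMinimalIdeal A') (hne : A' ≠ A) : Module.finrank F A' = 1 := by
  have hinf : ∀ x ∈ A', x ∈ A → x = 0 := by
    intro x hx' hx
    rcases hA.2.2 (A' ⊓ A) (hA'.1.inf hA.1) inf_le_right with h1 | h1
    · rw [← Submodule.mem_bot F, ← h1]
      exact ⟨hx', hx⟩
    · rcases hA'.2.2 A hA.1 (inf_eq_right.1 h1) with h2 | h2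
      · exact absurd h2 hA.2.1
      · exact absurd h2.symm hne
  -- Modulo `A`, the ideal `A'` becomes this nonzero ideal of `M`. An eigenvector in it has an
  -- `A'`-component that is an eigenvector of all of `L`, because products between `A` and `A'` lie
  -- in their zero intersection.
  let J : Submodule F M := (A ⊔ A').comap M.toSubmodule.subtype
  have hJ : IsIdeal J := fun m x hx => hA.1.sup hA'.1 m x hx
  obtain ⟨b, hb, hb0⟩ := Submodule.exists_mem_ne_zero_of_ne_bot hA'.2.1
  have hJ0 : J ≠ ⊥ := by
    intro hbot
    obtain ⟨a, ha, m, hm, rfl⟩ := h.exists_add b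
    have hmJ : (⟨m, hm⟩ : M) ∈ J := by
      change m ∈ A ⊔ A'
      have := sub_mem (Submodule.mem_sup_right (S := A) hb) (Submodule.mem_sup_left (T := A') ha)
      rwa [add_sub_cancel_left] at this
    rw [hbot, Submodule.mem_bot] at hmJ
    have hm0 : m = 0 := congrArg Subtype.val hmJ
    rw [hm0, add_zero] at hb hb0
    exact hb0 (hinf a hb ha)
  obtain ⟨v, hv, hv0, hev⟩ := hM.exists_eigenvector hJ hJ0
  obtain ⟨a, ha, a', ha', hva⟩ := Submodule.mem_sup.1 hv
  have hva : a + a' = (v : L) := hva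
  have key : ∀ x ∈ A, ∀ y ∈ A', ∀ c : F, x + y = c • (v : L) → y = c • a' := by
    intro x hx y hy c hxy
    refine sub_eq_zero.1 (hinf _ (sub_mem hy (Submodule.smul_mem _ c ha')) ?_)
    have : y - c • a' = c • a - x := by
      rw [sub_eq_sub_iff_add_eq_add, add_comm y x, hxy, ← hva, smul_add]
    rw [this]
    exact sub_mem (Submodule.smul_mem _ c ha) hx
  refine hA'.finrank_eq_one ha' ?_ fun l => ?_
  · rintro rfl
    rw [add_zero] at hva
    refine hv0 (Subtype.ext ?_)
    rw [← hva]
    exact h.eq_zero a ha (hva ▸ v.2)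
  · obtain ⟨x, hx, m, hm, rfl⟩ := h.exists_add l
    obtain ⟨⟨c, hc⟩, d, hd⟩ := hev ⟨m, hm⟩
    have hc : m * (v : L) = c • (v : L) := congrArg Subtype.val hc
    have hd : (v : L) * m = d • (v : L) := congrArg Subtype.val hd
    have hxa : x * a' = 0 := hinf _ (hA'.1 x a' ha').1 (hA.1 a' x hx).2
    have hax : a' * x = 0 := hinf _ (hA'.1 x a' ha').2 (hA.1 a' x hx).1
    rw [← hva, mul_add, hva] at hc
    rw [← hva, add_mul, hva] at hd
    refine ⟨⟨c, ?_⟩, d, ?_⟩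
    · rw [add_mul, hxa, zero_add]
      exact key _ (hA.1 m a ha).1 _ (hA'.1 m a' ha').1 c hc
    · rw [mul_add, hax, zero_add]
      exact key _ (hA.1 m a ha).2 _ (hA'.1 m a' ha').2 d hd

/-- The complement acts faithfully on a unique minimal ideal. -/
theorem IsSplit.faithful {A : Submodule F L} {M : NonUnitalSubalgebra F L} (h : IsSplit A M)
    (hA : IsUniqueMinimalIdeal A) : ∀ m ∈ M, (∀ a ∈ A, m * a = 0) → m = 0 := by
  -- The annihilator of `A` in `M` is an ideal of `L` meeting `A` trivially, so it cannot contain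
  -- the unique minimal ideal.
  let C : Submodule F L :=
    { carrier := {m | m ∈ M ∧ ∀ a ∈ A, m * a = 0}
      add_mem' := fun {x y} hx hy => ⟨add_mem hx.1 hy.1, fun a ha => by
        rw [add_mul, hx.2 a ha, hy.2 a ha, add_zero]⟩
      zero_mem' := ⟨zero_mem _, fun a _ => zero_mul a⟩
      smul_mem' := fun c x hx => ⟨SMulMemClass.smul_mem c hx.1, fun a ha => by
        rw [smul_mul_assoc, hx.2 a ha, smul_zero]⟩ }
  have hC : IsIdeal C := by
    rintro l x ⟨hxM, hxA⟩
    obtain ⟨b, hb, m, hm, rfl⟩ := h.exists_add l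
    have hbx : b * x = 0 := by
      rcases h.right_mul b hb x with h' | h'
      · exact h'
      · rw [h', hxA b hb, neg_zero]
    rw [add_mul, mul_add, hbx, hxA b hb, zero_add, zero_add]
    refine ⟨⟨M.mul_mem hm hxM, fun a ha => ?_⟩, M.mul_mem hxM hm, fun a ha => ?_⟩
    · rw [mul_mul_eq_sub, hxA a ha, mul_zero, hxA _ (h.isIdeal m a ha).1, sub_zero]
    · rw [mul_mul_eq_sub, hxA a ha, mul_zero, hxA _ (h.isIdeal m a ha).1, sub_zero]
  intro m hm hmA
  by_contra hm0
  have hC0 : C ≠ ⊥ := fun hbot => hm0 (by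
    rw [← Submodule.mem_bot F, ← hbot]
    exact ⟨hm, hmA⟩)
  obtain ⟨J, hJ, hJC⟩ := hC.exists_isMinimalIdeal_le hC0
  rw [hA.2 J hJ] at hJC
  exact hA.1.2.1 (eq_bot_iff.2 fun a ha => h.eq_zero a ha (hJC ha).1)

theorem exists_isCritical (hs : IsSolvable F L) (hphi : IsPhiFree F L)
    (hmin : IsMinimallyNonSupersolvable F L) :
    ∃ (A : Submodule F L) (M : NonUnitalSubalgebra F L), IsCritical A M ∧ IsSupersolvable F M := by
  have htop : (⊤ : Submodule F L) ≠ ⊥ := fun h =>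
    hmin.1 ⟨0, fun _ => ⊥, rfl, h.symm, fun _ _ => le_rfl,
      fun i hi => ⟨isIdeal_bot, by rw [finrank_bot]; omega⟩⟩
  have hdim : ∀ A : Submodule F L, IsMinimalIdeal A → Module.finrank F A ≠ 1 := by
    intro A hA h1
    obtain ⟨M, hM, hsplit⟩ := hA.exists_isSplit hs hphi
    exact hmin.1 (hsplit.isSupersolvable h1 (hmin.2 M hM))
  obtain ⟨A, hA, -⟩ := IsIdeal.exists_isMinimalIdeal_le (I := (⊤ : Submodule F L))
    (fun _ _ _ => ⟨trivial, trivial⟩) htop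
  obtain ⟨M, hM, h⟩ := hA.exists_isSplit hs hphi
  have hMs := hmin.2 M hM
  have hU : IsUniqueMinimalIdeal A := ⟨hA, fun J hJ => by
    by_contra hne
    exact hdim J hJ (h.finrank_eq_one_of_ne hMs hA hJ hne)⟩
  have hf := h.faithful hU
  have halt : ∀ m ∈ M, m * m = 0 := fun m hm => hf _ (M.mul_mem hm hm) fun a _ => by
    rw [mul_mul_eq_sub, sub_self]
  refine ⟨A, M, ⟨h, hU, hdim A hA, hf, fun W hW => ?_, halt, fun S hSM hS hne => ?_, ?_⟩, hMs⟩
  · have hid : IsIdeal (W.map A.subtype) := by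
      rintro l _ ⟨w, hw, rfl⟩
      obtain ⟨b, hb, m, hm, rfl⟩ := h.exists_add l
      have h1 : (b + m) * (w : L) ∈ W.map A.subtype := by
        rw [add_mul, h.mul_eq_zero b hb w w.2, zero_add]
        exact ⟨_, hW m hm w hw, rfl⟩
      refine ⟨h1, ?_⟩
      rcases h.right_mul w w.2 (b + m) with h' | h'
      · exact (congrArg (· ∈ W.map A.subtype) h').mpr (zero_mem _)
      · exact (congrArg (· ∈ W.map A.subtype) h').mpr (neg_mem h1)
    rcases hA.2.2 _ hid (Submodule.map_subtype_le A W) with h' | h'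
    · exact Or.inl (Submodule.map_injective_of_injective A.subtype_injective
        (h'.trans (Submodule.map_bot _).symm))
    · refine Or.inr (eq_top_iff.2 fun w _ => ?_)
      have hw : (w : L) ∈ W.map A.subtype := (congrArg ((w : L) ∈ ·) h').mpr w.2
      obtain ⟨w', hw', heq⟩ := hw
      rwa [← show w' = w from Subtype.ext heq]
  -- `A + S` is a proper subalgebra, hence supersolvable, and `A` is a nonzero ideal of it, so it
  -- contains an eigenvector.
  · let K : NonUnitalSubalgebra F L := (A ⊔ S).toNonUnitalSubalgebra (by
      intro x y hx hy
      obtain ⟨b, hb, m, hm, rfl⟩ := Submodule.mem_sup.1 hx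
      obtain ⟨c, hc, k, hk, rfl⟩ := Submodule.mem_sup.1 hy
      rw [mul_add, add_mul _ _ k, ← add_assoc]
      exact Submodule.add_mem_sup (add_mem (hA.1 _ c hc).1 (hA.1 k b hb).2) (hS m hm k hk))
    have hK : K ≠ ⊤ := by
      intro hK
      refine hne (le_antisymm hSM fun m hm => ?_)
      have hmK : m ∈ K := hK ▸ trivial
      obtain ⟨a, ha, s, hs, rfl⟩ := Submodule.mem_sup.1 hmK
      have haM : a ∈ M := by simpa using sub_mem hm (hSM hs)
      rwa [h.eq_zero a ha haM, zero_add]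
    have hJ : IsIdeal (A.comap K.toSubmodule.subtype : Submodule F K) :=
      fun k x hx => hA.1 k x hx
    have hJ0 : (A.comap K.toSubmodule.subtype : Submodule F K) ≠ ⊥ := by
      intro hbot
      obtain ⟨a, ha, ha0⟩ := Submodule.exists_mem_ne_zero_of_ne_bot hA.2.1
      have haJ : (⟨a, Submodule.mem_sup_left ha⟩ : K) ∈
        (A.comap K.toSubmodule.subtype : Submodule F K) := ha
      rw [hbot, Submodule.mem_bot] at haJ
      exact ha0 (congrArg Subtype.val haJ)
    obtain ⟨v, hv, hv0, hev⟩ := (hmin.2 K hK).exists_eigenvector hJ hJ0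
    refine ⟨v, hv, fun h0 => hv0 (Subtype.ext h0), fun s hs => ?_⟩
    obtain ⟨c, hc⟩ := (hev ⟨s, Submodule.mem_sup_right hs⟩).1
    exact ⟨c, congrArg Subtype.val hc⟩
  · have hsq : ∀ a ∈ A, ∀ m ∈ M, (a + m) * (a + m) = a * m + m * a := by
      intro a ha m hm
      rw [mul_add, add_mul, add_mul, h.mul_eq_zero a ha a ha, halt m hm, zero_add, add_zero,
        add_comm]
    rcases hA.le_leib_or with h' | h'
    · refine Or.inr (le_antisymm h' (Submodule.span_le.2 ?_))
      rintro _ ⟨l, rfl⟩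
      obtain ⟨a, ha, m, hm, rfl⟩ := h.exists_add l
      rw [hsq a ha m hm]
      exact add_mem (hA.1 m a ha).2 (hA.1 m a ha).1
    · refine Or.inl fun l => ?_
      obtain ⟨a, ha, m, hm, rfl⟩ := h.exists_add l
      rw [hsq a ha m hm, h' a ha m, neg_add_cancel]

end Forward

/-! ### The two types are minimally non-supersolvable. -/

section Converse

variable {F : Type*} [Field F] {L : Type*} [NonUnitalNonAssocRing L] [Module F L]
  [IsScalarTower F L L] [SMulCommClass F L L] [IsLeibniz L] [FiniteDimensional F L] [IsAlgClosed F]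

/-- The dichotomy for subalgebras `K` is what remains to be checked for each type: either `K` is
abelian modulo `A`, or `K` covers `L / A`, and then a proper `K` meets `A` trivially and inherits
products on a line from `L / A`. -/
theorem IsSplit.isMinimallyNonSupersolvable {A : Submodule F L} {M : NonUnitalSubalgebra F L}
    (h : IsSplit A M) (hA : IsUniqueMinimalIdeal A) (hdim : Module.finrank F A ≠ 1) {c : L}
    (hcc : c * c = 0) (hc : ∀ m ∈ M, ∀ k ∈ M, ∃ r : F, m * k = r • c)
    (hK : ∀ K : NonUnitalSubalgebra F L, (∀ k ∈ K, ∀ k' ∈ K, k * k' ∈ A) ∨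
      ∀ l, ∃ a ∈ A, ∃ k ∈ K, l = a + k) :
    IsSolvable F L ∧ IsPhiFree F L ∧ IsMinimallyNonSupersolvable F L := by
  have hmul : ∀ x y : L, ∃ a ∈ A, ∃ r : F, x * y = a + r • c := by
    intro x y
    obtain ⟨a, ha, m, hm, rfl⟩ := h.exists_add x
    obtain ⟨b, hb, k, hk, rfl⟩ := h.exists_add y
    obtain ⟨r, hr⟩ := hc m hm k hk
    refine ⟨(a + m) * b + a * k, add_mem (h.isIdeal _ b hb).1 (h.isIdeal k a ha).2, r, ?_⟩
    rw [mul_add, add_mul _ _ k, hr, add_assoc]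
  refine ⟨⟨3, ?_⟩, isPhiFree_of_isCoatom hA (h.isCoatom hA.1) h.eq_zero, fun hss => ?_,
    fun K hKT => ?_⟩
  · have h1 : derivedSeries F L 1 ≤ A ⊔ F ∙ c := by
      refine Submodule.span_le.2 ?_
      rintro _ ⟨x, -, y, -, rfl⟩
      obtain ⟨a, ha, r, hr⟩ := hmul x y
      rw [hr]
      exact Submodule.add_mem_sup ha
        (Submodule.smul_mem _ _ (Submodule.mem_span_singleton_self c))
    have h2 : derivedSeries F L 2 ≤ A := by
      refine Submodule.span_le.2 ?_
      rintro _ ⟨x, hx, y, hy, rfl⟩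
      obtain ⟨a, ha, s, hs, rfl⟩ := Submodule.mem_sup.1 (h1 hx)
      obtain ⟨b, hb, t, ht, rfl⟩ := Submodule.mem_sup.1 (h1 hy)
      obtain ⟨s, rfl⟩ := Submodule.mem_span_singleton.1 hs
      obtain ⟨t, rfl⟩ := Submodule.mem_span_singleton.1 ht
      rw [mul_add, add_mul _ _ (t • c), smul_mul_smul_comm, hcc, smul_zero, add_zero]
      exact add_mem (h.isIdeal _ b hb).1 (h.isIdeal _ a ha).2
    refine eq_bot_iff.2 (Submodule.span_le.2 ?_)
    rintro _ ⟨x, hx, y, hy, rfl⟩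
    exact h.mul_eq_zero x (h2 hx) y (h2 hy)
  · obtain ⟨v, hv, hv0, hev⟩ := hss.exists_eigenvector hA.1.1 hA.1.2.1
    exact hdim (hA.1.finrank_eq_one hv hv0 hev)
  · rcases hK K with hKA | hadd
    · refine isSupersolvable_of_mul_mem (L := K) (A := A.comap K.toSubmodule.subtype)
        (fun k x hx => h.isIdeal k x hx)
        (fun a ha b hb => Subtype.ext (h.mul_eq_zero a ha b hb))
        (fun a ha x => ?_) (fun a b => hKA a a.2 b b.2)
      exact (h.right_mul a ha x).imp (fun h => Subtype.ext h) (fun h => Subtype.ext h)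
    · have hKinf : ∀ a ∈ A, a ∈ K → a = 0 := by
        intro a ha haK
        rcases hA.1.2.2 _ (isIdeal_inf_of_add_eq h.isIdeal h.mul_eq_zero hadd) inf_le_right
          with h' | h'
        · rw [← Submodule.mem_bot F, ← h']
          exact ⟨haK, ha⟩
        · refine absurd (eq_top_iff.2 fun l _ => ?_) hKT
          obtain ⟨a, ha, k, hk, rfl⟩ := hadd l
          exact add_mem (inf_eq_right.1 h' ha) hk
      -- The line of products of `K` is spanned by the representative `c'` in `K` of `c` modulo `A`.
      obtain ⟨a₀, ha₀, c', hc', hcc'⟩ := hadd c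
      refine isSupersolvable_of_mul_eq_smul (L := K) ⟨c', hc'⟩ fun x y => ?_
      obtain ⟨a, ha, r, hr⟩ := hmul x y
      refine ⟨r, Subtype.ext (sub_eq_zero.1 (hKinf ((x : L) * y - r • c') ?_
        (sub_mem (K.mul_mem x.2 y.2) (SMulMemClass.smul_mem r hc'))))⟩
      rw [hr, hcc', smul_add, ← add_assoc, add_sub_cancel_right]
      exact add_mem ha (Submodule.smul_mem _ _ ha₀)

/-- Construction of a splitting from a basis adapted to it. -/
theorem isSplit_of_basis {ι κ : Type*} {e : ι → L} {b : κ → L}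
    (hli : LinearIndependent F (Sum.elim e b))
    (hsp : Submodule.span F (Set.range (Sum.elim e b)) = ⊤)
    (hmin : IsMinimalIdeal (Submodule.span F (Set.range e))) (hee : ∀ i j, e i * e j = 0)
    {M : NonUnitalSubalgebra F L} (hM : M.toSubmodule = Submodule.span F (Set.range b)) :
    IsSplit (Submodule.span F (Set.range e)) M := by
  refine ⟨hmin.1, fun x hx y hy => ?_, hmin.mul_eq_zero_or, fun a ha haM => ?_, fun l => ?_⟩
  · induction hx, hy using Submodule.span_induction₂ with
    | mem_mem x y hx hy =>
      obtain ⟨i, rfl⟩ := hx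
      obtain ⟨j, rfl⟩ := hy
      exact hee i j
    | zero_left y _ => exact zero_mul y
    | zero_right x _ => exact mul_zero x
    | add_left x y z _ _ _ h1 h2 => rw [add_mul, h1, h2, add_zero]
    | add_right x y z _ _ _ h1 h2 => rw [mul_add, h1, h2, add_zero]
    | smul_left r x y _ _ h1 => rw [smul_mul_assoc, h1, smul_zero]
    | smul_right r x y _ _ h1 => rw [mul_smul_comm, h1, smul_zero]
  · have hd := (linearIndependent_sum.1 hli).2.2
    refine Submodule.disjoint_def.1 hd a ha ?_
    have : a ∈ M.toSubmodule := haM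
    rwa [hM] at this
  · rw [Set.Sum.elim_range, Submodule.span_union, ← hM] at hsp
    have hl : l ∈ Submodule.span F (Set.range e) ⊔ M.toSubmodule := hsp ▸ Submodule.mem_top
    obtain ⟨a, ha, m, hm, rfl⟩ := Submodule.mem_sup.1 hl
    exact ⟨a, ha, m, hm, rfl⟩

theorem finrank_span_range_ne_one {p : ℕ} (hp : p.Prime) {e : ZMod p → L}
    (he : LinearIndependent F e) : Module.finrank F (Submodule.span F (Set.range e)) ≠ 1 := by
  have : NeZero p := ⟨hp.ne_zero⟩
  rw [finrank_span_eq_card he, ZMod.card]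
  exact hp.one_lt.ne'

theorem IsTypeA.isMinimallyNonSupersolvable {p : ℕ} (hp : p.Prime) (h : IsTypeA F L p) :
    IsSolvable F L ∧ IsPhiFree F L ∧ IsMinimallyNonSupersolvable F L := by
  obtain ⟨e, x, y, hli, hsp, hU, hee, -, -, hxy, hyx, hxx, hyy, -⟩ := h
  have hprod : ∀ a₁ a₂ b₁ b₂ : F,
      (a₁ • x + a₂ • y) * (b₁ • x + b₂ • y) = (a₁ * b₂ - a₂ * b₁) • x := by
    intro a₁ a₂ b₁ b₂
    simp only [mul_add, add_mul, mul_smul_comm, smul_mul_assoc, hxy, hyx, hxx, hyy]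
    module
  have hr : Submodule.span F (Set.range ![x, y]) = Submodule.span F {x, y} := by
    rw [Matrix.range_cons, Matrix.range_cons, Matrix.range_empty, Set.union_empty]
    rfl
  have hmul : ∀ m ∈ Submodule.span F {x, y}, ∀ k ∈ Submodule.span F {x, y},
      ∃ r : F, m * k = r • x := by
    intro m hm k hk
    obtain ⟨a₁, a₂, rfl⟩ := Submodule.mem_span_pair.1 hm
    obtain ⟨b₁, b₂, rfl⟩ := Submodule.mem_span_pair.1 hk
    exact ⟨_, hprod a₁ a₂ b₁ b₂⟩
  let M : NonUnitalSubalgebra F L := (Submodule.span F {x, y}).toNonUnitalSubalgebra (by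
    intro m k hm hk
    obtain ⟨r, hr⟩ := hmul m hm k hk
    rw [hr]
    exact Submodule.smul_mem _ _ (Submodule.subset_span (by simp)))
  have hsplit := isSplit_of_basis hli hsp hU.1 hee (M := M) hr.symm
  refine hsplit.isMinimallyNonSupersolvable hU
    (finrank_span_range_ne_one hp (linearIndependent_sum.1 hli).1) hxx hmul fun K => ?_
  set A := Submodule.span F (Set.range e)
  refine or_iff_not_imp_left.2 fun hcon => ?_
  push Not at hcon
  obtain ⟨k, hk, k', hk', hkk⟩ := hcon
  obtain ⟨a, ha, m, hm, rfl⟩ := hsplit.exists_add k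
  obtain ⟨a', ha', m', hm', rfl⟩ := hsplit.exists_add k'
  have hmW : m ∈ A ⊔ K.toSubmodule := by
    have := Submodule.add_mem_sup (neg_mem ha) (show a + m ∈ K.toSubmodule from hk)
    rwa [neg_add_cancel_left] at this
  have hmW' : m' ∈ A ⊔ K.toSubmodule := by
    have := Submodule.add_mem_sup (neg_mem ha') (show a' + m' ∈ K.toSubmodule from hk')
    rwa [neg_add_cancel_left] at this
  obtain ⟨a₁, a₂, rfl⟩ := Submodule.mem_span_pair.1 hm
  obtain ⟨b₁, b₂, rfl⟩ := Submodule.mem_span_pair.1 hm'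
  -- The product modulo `A` is this determinant times `x`. As it is nonzero, Cramer's rule recovers
  -- `x` and `y` from the two elements.
  have hd : a₁ * b₂ - a₂ * b₁ ≠ 0 := by
    intro hd
    refine hkk ?_
    rw [mul_add, add_mul _ _ (b₁ • x + b₂ • y), hprod, hd, zero_smul, add_zero]
    exact add_mem (hU.1.1 _ a' ha').1 (hU.1.1 _ a ha).2
  have hx : x ∈ A ⊔ K.toSubmodule := by
    refine (Submodule.smul_mem_iff _ hd).1 ?_
    have := sub_mem (Submodule.smul_mem _ b₂ hmW) (Submodule.smul_mem _ a₂ hmW')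
    convert this using 1
    module
  have hy : y ∈ A ⊔ K.toSubmodule := by
    refine (Submodule.smul_mem_iff _ hd).1 ?_
    have := sub_mem (Submodule.smul_mem _ a₁ hmW') (Submodule.smul_mem _ b₁ hmW)
    convert this using 1
    module
  intro l
  obtain ⟨b, hb, n, hn, rfl⟩ := hsplit.exists_add l
  have hn' : b + n ∈ A ⊔ K.toSubmodule := by
    refine add_mem (Submodule.mem_sup_left hb) (Submodule.span_le.2 ?_ hn)
    rintro _ (rfl | rfl) <;> assumption
  obtain ⟨c, hc, k, hk, h⟩ := Submodule.mem_sup.1 hn'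
  exact ⟨c, hc, k, hk, h.symm⟩

theorem IsTypeB.isMinimallyNonSupersolvable {p : ℕ} (hp : p.Prime) (h : IsTypeB F L p) :
    IsSolvable F L ∧ IsPhiFree F L ∧ IsMinimallyNonSupersolvable F L := by
  obtain ⟨e, x, y, z, hli, hsp, hU, hee, -, -, -, hxy, hyx, hxx, hyy, hzz, hxz, hzx, hyz, hzy, -⟩ :=
    h
  have hprod : ∀ a₁ a₂ a₃ b₁ b₂ b₃ : F,
      (a₁ • x + a₂ • y + a₃ • z) * (b₁ • x + b₂ • y + b₃ • z) = (a₁ * b₂ - a₂ * b₁) • z := by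
    intro a₁ a₂ a₃ b₁ b₂ b₃
    simp only [mul_add, add_mul, mul_smul_comm, smul_mul_assoc, hxy, hyx, hxx, hyy, hzz, hxz, hzx,
      hyz, hzy]
    module
  have hr : Submodule.span F (Set.range ![x, y, z]) = Submodule.span F {x, y, z} := by
    rw [Matrix.range_cons, Matrix.range_cons, Matrix.range_cons, Matrix.range_empty,
      Set.union_empty]
    rfl
  have hmul : ∀ m ∈ Submodule.span F {x, y, z}, ∀ k ∈ Submodule.span F {x, y, z},
      ∃ r : F, m * k = r • z := by
    intro m hm k hk
    obtain ⟨a₁, a₂, a₃, rfl⟩ := Submodule.mem_span_triple.1 hm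
    obtain ⟨b₁, b₂, b₃, rfl⟩ := Submodule.mem_span_triple.1 hk
    exact ⟨_, hprod a₁ a₂ a₃ b₁ b₂ b₃⟩
  let M : NonUnitalSubalgebra F L := (Submodule.span F {x, y, z}).toNonUnitalSubalgebra (by
    intro m k hm hk
    obtain ⟨r, hr⟩ := hmul m hm k hk
    rw [hr]
    exact Submodule.smul_mem _ _ (Submodule.subset_span (by simp)))
  have hsplit := isSplit_of_basis hli hsp hU.1 hee (M := M) hr.symm
  refine hsplit.isMinimallyNonSupersolvable hU
    (finrank_span_range_ne_one hp (linearIndependent_sum.1 hli).1) hzz hmul fun K => ?_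
  set A := Submodule.span F (Set.range e)
  refine or_iff_not_imp_left.2 fun hcon => ?_
  push Not at hcon
  obtain ⟨k, hk, k', hk', hkk⟩ := hcon
  have hkkK : k * k' ∈ K := K.mul_mem hk hk'
  obtain ⟨a, ha, m, hm, rfl⟩ := hsplit.exists_add k
  obtain ⟨a', ha', m', hm', rfl⟩ := hsplit.exists_add k'
  have hmW : m ∈ A ⊔ K.toSubmodule := by
    have := Submodule.add_mem_sup (neg_mem ha) (show a + m ∈ K.toSubmodule from hk)
    rwa [neg_add_cancel_left] at this
  have hmW' : m' ∈ A ⊔ K.toSubmodule := by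
    have := Submodule.add_mem_sup (neg_mem ha') (show a' + m' ∈ K.toSubmodule from hk')
    rwa [neg_add_cancel_left] at this
  obtain ⟨a₁, a₂, a₃, rfl⟩ := Submodule.mem_span_triple.1 hm
  obtain ⟨b₁, b₂, b₃, rfl⟩ := Submodule.mem_span_triple.1 hm'
  rw [mul_add, add_mul _ _ (b₁ • x + b₂ • y + b₃ • z), hprod, ← add_assoc] at hkk hkkK
  have hcross := add_mem (hU.1.1 (a + (a₁ • x + a₂ • y + a₃ • z)) a' ha').1
    (hU.1.1 (b₁ • x + b₂ • y + b₃ • z) a ha).2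
  have hd : a₁ * b₂ - a₂ * b₁ ≠ 0 := by
    intro hd
    refine hkk ?_
    rwa [hd, zero_smul, add_zero]
  -- Modulo `A`, the product of the two elements of `K` is a nonzero multiple of `z`. With `z`
  -- available, Cramer's rule gives `x` and `y` once the `z`-components are subtracted.
  have hz : z ∈ A ⊔ K.toSubmodule := by
    refine (Submodule.smul_mem_iff _ hd).1 ?_
    have := Submodule.add_mem_sup (T := K.toSubmodule) (neg_mem hcross) hkkK
    rwa [neg_add_cancel_left] at this
  have hx : x ∈ A ⊔ K.toSubmodule := by
    refine (Submodule.smul_mem_iff _ hd).1 ?_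
    have := sub_mem (sub_mem (Submodule.smul_mem _ b₂ hmW) (Submodule.smul_mem _ a₂ hmW'))
      (Submodule.smul_mem _ (b₂ * a₃ - a₂ * b₃) hz)
    convert this using 1
    module
  have hy : y ∈ A ⊔ K.toSubmodule := by
    refine (Submodule.smul_mem_iff _ hd).1 ?_
    have := sub_mem (sub_mem (Submodule.smul_mem _ a₁ hmW') (Submodule.smul_mem _ b₁ hmW))
      (Submodule.smul_mem _ (a₁ * b₃ - b₁ * a₃) hz)
    convert this using 1
    module
  intro l
  obtain ⟨b, hb, n, hn, rfl⟩ := hsplit.exists_add l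
  have hn' : b + n ∈ A ⊔ K.toSubmodule := by
    refine add_mem (Submodule.mem_sup_left hb) (Submodule.span_le.2 ?_ hn)
    rintro _ (rfl | rfl | rfl) <;> assumption
  obtain ⟨c, hc, k, hk, h⟩ := Submodule.mem_sup.1 hn'
  exact ⟨c, hc, k, hk, h.symm⟩

end Converse
end Leibniz

theorem mainTheorem4 {F : Type*} [Field F] [IsAlgClosed F]
    {L : Type*} [NonUnitalNonAssocRing L] [Module F L] [IsScalarTower F L L]
    [SMulCommClass F L L] [IsLeibniz L] [FiniteDimensional F L] :
    (Leibniz.IsSolvable F L ∧ Leibniz.IsPhiFree F L ∧ Leibniz.IsMinimallyNonSupersolvable F L) ↔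
      ∃ p : ℕ, p.Prime ∧ CharP F p ∧ (Leibniz.IsTypeA F L p ∨ Leibniz.IsTypeB F L p) := by
  constructor
  · rintro ⟨hs, hphi, hmin⟩
    obtain ⟨A, M, h, hM⟩ := Leibniz.exists_isCritical hs hphi hmin
    exact h.exists_type hM
  · rintro ⟨p, hp, -, h | h⟩
    · exact h.isMinimallyNonSupersolvable hp
    · exact h.isMinimallyNonSupersolvable hp
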